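/- Let $d,s,n\ge 1$ be integers, let $k_1,\dots,k_n\in\mathbb R^d$ and $v_1,\dots,v_n\in\mathbb R^s$, let $\delta>0$, and let $C=\{(k_1,v_1),\dots,(k_n,v_n)\}$ be the dataset of pairs, indexed by $[n]=\{1,\dots,n\}$, so that $|C|=n$. The randomized algorithm SoftmaxBalance with radii $r_{\mathrm{key}},r_{\mathrm{value}}$ and failure parameter $\delta$ is the following. Put $R=\exp(r_{\mathrm{key}}^2/(2\sqrt d))\,r_{\mathrm{value}}$ and $c=30\log(n/\delta)$. For $j=1,\dots,n$ compute $t_j=\sum_{i<j}\exp(\langle k_i,k_j\rangle/\sqrt d)\langle v_i,v_j\rangle\,\eta_i$; if $|t_j|>cR^2$, stop and output FAIL; otherwise let $\eta_j=+1$ with probability $\frac12-\frac{t_j}{2cR^2}$ (read as $\frac12$ if $cR^2=0$), independently of the earlier coin tosses, and $\eta_j=-1$ otherwise. At the end, output the pairs $(k_i,v_i)$ with $\eta_i=+1$ if there are at most as many of them as pairs with $\eta_i=-1$, and the pairs with $\eta_i=-1$ otherwise. There are an absolute constant $K>0$ and a single program $P$ for a randomized real-RAM (unit-cost arithmetic,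 $\exp$, $\log$, $\sqrt{\cdot}$, comparisons, memory accesses and coin tosses of a computed bias) such that for all such $d,s,n,(k_j),(v_j)$ and all $\delta>0$ the following hold for $P$ on input $(k_j)_j,(v_j)_j,\delta$. 1. The output of $P$ has the distribution of the output of SoftmaxBalance with $r_{\mathrm{key}}=\max_j\|k_j\|_2$, $r_{\mathrm{value}}=\max_j\|v_j\|_2$ and failure parameter $\delta$. 2. Whenever the output is not FAIL, it is a subset $C'\subset C$ with $|C'|\le |C|/2$. 3. If $\delta\le ns/2$, then for every $q\in\mathbb R^d$, with probability at least $1-\delta$ the output is not FAIL and $$\Bigl\|\sum_{(k,v)\in C'}\exp\Bigl(\tfrac{\langle k,q\rangle}{\sqrt d}\Bigr)v-\sum_{(k,v)\in C\setminus C'}\exp\Bigl(\tfrac{\langle k,q\rangle}{\sqrt d}\Bigr)v\Bigr\|_2\le K\sqrt s\,\log\Bigl(\frac{ns}\delta\Bigr)\exp\Bigl(\frac{\|q\|_2^2}{2\sqrt d}\Bigr)\exp\Bigl(\max_{j\in[n]}\frac{\|k_j\|_2^2}{2\sqrt d}\Bigr)\max_{j\in[n]}\|v_j\|_2 .$$ 4.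 For all outcomes of the coin tosses, $P$ makes at most $K(d+s)n^2$ elementary steps and uses at most $K(d+s)n$ memory cells, including those that hold the input. -/

import Mathlib

noncomputable section

/-- A biased coin: `true` with probability `p` (clamped to `[0, 1]`), `false` otherwise. -/
def coin (p : ℝ) : PMF Bool :=
  PMF.ofFintype
    (fun b => ENNReal.ofReal (if b then max 0 (min 1 p) else 1 - max 0 (min 1 p))) (by
      have h0 : 0 ≤ max 0 (min 1 p) := le_max_left _ _
      have h1 : max 0 (min 1 p) ≤ 1 := max_le zero_le_one (min_le_left _ _)
      rw [Fintype.sum_bool, ← ENNReal.ofReal_add (by simp [h0]) (by simp [h1])]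
      simp)

/-! ### The algorithm SoftmaxBalance -/

namespace SoftmaxBalance

variable {d s n : ℕ}

/-- The scale `R = exp (rKey ^ 2 / (2 √d)) * rValue`. -/
def scale (d : ℕ) (rKey rValue : ℝ) : ℝ :=
  Real.exp (rKey ^ 2 / (2 * Real.sqrt d)) * rValue

/-- The threshold `c = 30 log (n / δ)`. -/
def threshold (n : ℕ) (δ : ℝ) : ℝ := 30 * Real.log (n / δ)

/-- The number `yᵀ η` computed in round `j`, where
`y = (exp (⟨k i, k j⟩ / √d) * ⟨v i, v j⟩)_{i ≤ j}`. -/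
def correlation (k : Fin n → EuclideanSpace ℝ (Fin d)) (v : Fin n → EuclideanSpace ℝ (Fin s))
    (η : Fin n → ℝ) (j : Fin n) : ℝ :=
  ∑ i ∈ Finset.Iic j,
    (Real.exp (inner ℝ (k i) (k j) / Real.sqrt d) * inner ℝ (v i) (v j)) * η i

/-- The main loop over the list of indices still to be processed, with the current sign vector `η`
(`0` at the indices that have not been processed); `c` is the threshold and `R` the scale.
`none` is the outcome FAIL. -/
def signs (k : Fin n → EuclideanSpace ℝ (Fin d)) (v : Fin n → EuclideanSpace ℝ (Fin s))
    (c R : ℝ) : List (Fin n) → (Fin n → ℝ) → PMF (Option (Fin n → ℝ))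
  | [], η => PMF.pure (some η)
  | j :: l, η =>
    if c * R ^ 2 < |correlation k v η j| then PMF.pure none
    else (coin (1 / 2 - correlation k v η j / (2 * c * R ^ 2))).bind fun b =>
      signs k v c R l (Function.update η j (if b then 1 else -1))

/-- The smaller one of the two classes of a sign vector (the class of `+1` if they tie). -/
def select (η : Fin n → ℝ) : Finset (Fin n) :=
  if (Finset.univ.filter fun i => η i = 1).card ≤ (Finset.univ.filter fun i => η i = -1).card
  then Finset.univ.filter fun i => η i = 1
  else Finset.univ.filter fun i => η i = -1

/-- The distribution of the output of SoftmaxBalance on the pairs `(k 0, v 0), …`, with radii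
`rKey`, `rValue` and failure parameter `δ`: `none` is FAIL, and `some S` is the subset
`{(k i, v i) : i ∈ S}` of the dataset. -/
def law (k : Fin n → EuclideanSpace ℝ (Fin d)) (v : Fin n → EuclideanSpace ℝ (Fin s))
    (rKey rValue δ : ℝ) : PMF (Option (Finset (Fin n))) :=
  (signs k v (threshold n δ) (scale d rKey rValue) (List.finRange n) 0).map (Option.map select)

/-- `∑_{i ∈ S} exp (⟨k i, q⟩ / √d) • v i`. -/
def expSum (k : Fin n → EuclideanSpace ℝ (Fin d)) (v : Fin n → EuclideanSpace ℝ (Fin s))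
    (q : EuclideanSpace ℝ (Fin d)) (S : Finset (Fin n)) : EuclideanSpace ℝ (Fin s) :=
  ∑ i ∈ S, Real.exp (inner ℝ (k i) q / Real.sqrt d) • v i

end SoftmaxBalance

/-! ### A randomized real-RAM with unit costs -/

namespace RealRAM

/-- A machine state: integer registers (used as loop counters and for addresses), a memory of real
cells, the number `time` of elementary steps made so far, and the memory bound `space`: every
address used so far is `< space`, and every integer written to a register so far is `≤ space`
(so that integer registers cannot serve as hidden storage). -/
structure State where
  reg : ℕ → ℕ
  mem : ℕ → ℝ
  time : ℕ
  space : ℕ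

/-- Integer expressions: constants, registers, sums and products. -/
inductive NExp where
  | const (c : ℕ)
  | reg (r : ℕ)
  | add (a b : NExp)
  | mul (a b : NExp)

/-- The value of an integer expression. -/
def NExp.val (σ : State) : NExp → ℕ
  | const c => c
  | reg r => σ.reg r
  | add a b => a.val σ + b.val σ
  | mul a b => a.val σ * b.val σ

/-- The number of elementary steps of the evaluation of an integer expression. -/
def NExp.cost : NExp → ℕ
  | const _ => 1
  | reg _ => 1
  | add a b => a.cost + b.cost + 1
  | mul a b => a.cost + b.cost + 1

/-- Real expressions: integers, memory cells (with computed addresses), the field operations, and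
the functions `exp`, `log`, `√`. -/
inductive RExp where
  | nat (a : NExp)
  | cell (a : NExp)
  | add (x y : RExp)
  | sub (x y : RExp)
  | mul (x y : RExp)
  | div (x y : RExp)
  | exp (x : RExp)
  | log (x : RExp)
  | sqrt (x : RExp)

/-- The value of a real expression. -/
def RExp.val (σ : State) : RExp → ℝ
  | nat a => (a.val σ : ℝ)
  | cell a => σ.mem (a.val σ)
  | add x y => x.val σ + y.val σ
  | sub x y => x.val σ - y.val σ
  | mul x y => x.val σ * y.val σ
  | div x y => x.val σ / y.val σ
  | exp x => Real.exp (x.val σ)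
  | log x => Real.log (x.val σ)
  | sqrt x => Real.sqrt (x.val σ)

/-- The number of elementary steps of the evaluation of a real expression. -/
def RExp.cost : RExp → ℕ
  | nat a => a.cost + 1
  | cell a => a.cost + 1
  | add x y => x.cost + y.cost + 1
  | sub x y => x.cost + y.cost + 1
  | mul x y => x.cost + y.cost + 1
  | div x y => x.cost + y.cost + 1
  | exp x => x.cost + 1
  | log x => x.cost + 1
  | sqrt x => x.cost + 1

/-- The least number that exceeds all addresses read by the evaluation of a real expression. -/
def RExp.top (σ : State) : RExp → ℕ
  | nat _ => 0
  | cell a => a.val σ + 1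
  | add x y => max (x.top σ) (y.top σ)
  | sub x y => max (x.top σ) (y.top σ)
  | mul x y => max (x.top σ) (y.top σ)
  | div x y => max (x.top σ) (y.top σ)
  | exp x => x.top σ
  | log x => x.top σ
  | sqrt x => x.top σ

/-- Programs.
* `skip` does nothing;
* `setReg r a` writes the integer `a` to register `r`;
* `setCell a x` writes the real `x` to the memory cell with address `a`;
* `flip a x` tosses a coin of bias `x` and writes `1` (with probability `x`) or `0` to cell `a`;
* `seq P Q` runs `P`, then `Q`;
* `ifLe x y P Q` runs `P` if `x ≤ y`, else `Q`;
* `loop r a P` runs `P` with register `r` set to `0, 1, …, a - 1` in turn, for the value that `a`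
  has at the beginning. -/
inductive Program where
  | skip
  | setReg (r : ℕ) (a : NExp)
  | setCell (a : NExp) (x : RExp)
  | flip (a : NExp) (x : RExp)
  | seq (P Q : Program)
  | ifLe (x y : RExp) (P Q : Program)
  | loop (r : ℕ) (a : NExp) (P : Program)

namespace State

/-- Charge `t` elementary steps and memory up to `m`. -/
def charge (σ : State) (t m : ℕ) : State :=
  { σ with time := σ.time + t, space := max σ.space m }

/-- Write the integer `a` to register `r`. -/
def writeReg (σ : State) (r a : ℕ) : State :=
  { σ with reg := Function.update σ.reg r a }

/-- Write the real `x` to cell `a`. -/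
def writeCell (σ : State) (a : ℕ) (x : ℝ) : State :=
  { σ with mem := Function.update σ.mem a x }

end State

/-- Run `body` for the values `0, …, m - 1` of register `r`; each round costs one step more than
its body. -/
def iterate (r : ℕ) (body : State → PMF State) : ℕ → State → PMF State
  | 0, σ => PMF.pure σ
  | m + 1, σ => (iterate r body m σ).bind fun τ => body ((τ.charge 1 m).writeReg r m)

/-- The distribution of the final state of a program that is started in a given state. -/
def Program.eval : Program → State → PMF State
  | skip, σ => PMF.pure (σ.charge 1 0)
  | setReg r a, σ => PMF.pure ((σ.charge (a.cost + 1) (a.val σ)).writeReg r (a.val σ))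
  | setCell a x, σ =>
    PMF.pure ((σ.charge (a.cost + x.cost + 1) (max (x.top σ) (a.val σ + 1))).writeCell
      (a.val σ) (x.val σ))
  | flip a x, σ =>
    (coin (x.val σ)).map fun b =>
      (σ.charge (a.cost + x.cost + 1) (max (x.top σ) (a.val σ + 1))).writeCell
        (a.val σ) (if b then 1 else 0)
  | seq P Q, σ => (P.eval σ).bind Q.eval
  | ifLe x y P Q, σ =>
    if x.val σ ≤ y.val σ then P.eval (σ.charge (x.cost + y.cost + 1) (max (x.top σ) (y.top σ)))
    else Q.eval (σ.charge (x.cost + y.cost + 1) (max (x.top σ) (y.top σ)))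
  | loop r a P, σ => iterate r P.eval (a.val σ) (σ.charge (a.cost + 1) 0)

variable {d s n : ℕ}

/-- The initial memory: `δ` in cell `0`; cells `1, …, n` are reserved for the output; then the keys
(coordinate `a` of `k j` in cell `n + 1 + d * j + a`), then the values (coordinate `b` of `v j` in
cell `n + 1 + n * d + s * j + b`); all other cells are `0`. -/
def inputMem (k : Fin n → EuclideanSpace ℝ (Fin d)) (v : Fin n → EuclideanSpace ℝ (Fin s))
    (δ : ℝ) (a : ℕ) : ℝ :=
  if a = 0 then δ
  else if a < n + 1 then 0
  else if h : a - (n + 1) < n * d then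
    let x := finProdFinEquiv.symm (⟨a - (n + 1), h⟩ : Fin (n * d))
    k x.1 x.2
  else if h : a - (n + 1 + n * d) < n * s then
    let x := finProdFinEquiv.symm (⟨a - (n + 1 + n * d), h⟩ : Fin (n * s))
    v x.1 x.2
  else 0

/-- The initial state: registers `0`, `1`, `2` hold `n`, `d`, `s`, and all other ones `0`; the
memory that the input occupies is charged from the start. -/
def input (k : Fin n → EuclideanSpace ℝ (Fin d)) (v : Fin n → EuclideanSpace ℝ (Fin s))
    (δ : ℝ) : State where
  reg r := if r = 0 then n else if r = 1 then d else if r = 2 then s else 0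
  mem := inputMem k v δ
  time := 0
  space := n + 1 + n * d + n * s

/-- Reading off the output: FAIL (`none`) unless cell `0` holds `1`; otherwise the set of those
indices `i` for which cell `1 + i` holds `1`. -/
def output (n : ℕ) (σ : State) : Option (Finset (Fin n)) :=
  if σ.mem 0 = 1 then some (Finset.univ.filter fun i : Fin n => σ.mem (1 + i) = 1) else none

/-- The distribution of the final state of a program on the given input. -/
def Program.run (P : Program) (k : Fin n → EuclideanSpace ℝ (Fin d))
    (v : Fin n → EuclideanSpace ℝ (Fin s)) (δ : ℝ) : PMF State :=
  P.eval (input k v δ)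

end RealRAM

end

/-! The kernel `exp (⟨x, y⟩ / √d) * ⟨v, w⟩` is an inner product `⟨Φ x v, Φ y w⟩` in a Hilbert space
(`exists_softmax_feature`). With `U i = Φ (k i) (v i)`, of norm at most `R`, the algorithm is a
self-balancing walk with position `w = ∑ η i • U i`: the computed correlation is `⟨w, U j⟩`, and the
coin pushes `w` against it. Coordinate `b` of the signed sum to be bounded is `⟨Φ q e_b, w⟩`, so a
tail bound for linear functionals of `w` suffices.

That bound comes from an exponential supermartingale. Put `M = c * R ^ 2`. By Hoeffding's lemma,
averaging `exp (⟨θ, w⟩ + a)` over a step along `u` gives at most the same expression for `θ - (⟨θ,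
u⟩ / M) • u` and `a + ⟨θ, u⟩ ^ 2 / 2` (`potential_balance_le`). The shortening of `θ` pays for the
growth of `a`: `a + M * ‖θ‖ ^ 2 / 2` does not increase (`budget_balanceStep_le`). A failure at round
`j` is itself detected by the functionals `± U j / R ^ 2` with tilt `-c`. Pulling everything back to
the start, where `w = 0`, bounds the probability of failing or of ending badly (`exists_potential`,
`signs_tail`); `guarantee` then picks the tilt.

The program is tied to the walk by a coupling of final machine states with outcomes of the walk
(`coupled_softmaxBalance`). Its relation contains both the equality of outputs and the resource
bounds, so it yields the law of the output and bounds that hold for every outcome of the coins. -/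

noncomputable section

/-! ### Feature maps of the exponential and softmax kernels -/

open MeasureTheory ProbabilityTheory in
/-- The Gaussian feature map of the exponential kernel. -/
theorem exists_exp_feature (d : ℕ) :
    ∃ φ : EuclideanSpace ℝ (Fin d) → Lp ℝ 2 (stdGaussian (EuclideanSpace ℝ (Fin d))),
      ∀ x y, inner ℝ (φ x) (φ y) = Real.exp (inner ℝ x y) := by
  set γ := stdGaussian (EuclideanSpace ℝ (Fin d)) with hγ
  have hlaw : ∀ x : EuclideanSpace ℝ (Fin d),
      γ.map (innerSL ℝ x) = gaussianReal 0 (‖x‖ ^ 2).toNNReal := by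
    intro x
    rw [IsGaussian.map_eq_gaussianReal, integral_strongDual_stdGaussian,
      variance_dual_stdGaussian, innerSL_apply_norm]
  have hint : ∀ x : EuclideanSpace ℝ (Fin d),
      Integrable (fun g => Real.exp (inner ℝ x g)) γ := by
    intro x
    have h := integrable_exp_mul_gaussianReal (μ := 0) (v := (‖x‖ ^ 2).toNNReal) 1
    rw [← hlaw x, integrable_map_measure (by fun_prop) (by fun_prop)] at h
    refine h.congr (Filter.Eventually.of_forall fun g => ?_)
    simp
  have hmgf : ∀ x : EuclideanSpace ℝ (Fin d),
      ∫ g, Real.exp (inner ℝ x g) ∂γ = Real.exp (‖x‖ ^ 2 / 2) := by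
    intro x
    have h := mgf_gaussianReal (hlaw x) 1
    simp only [mgf, one_mul, innerSL_apply_apply] at h
    rw [h, Real.coe_toNNReal _ (by positivity)]
    congr 1; ring
  -- The feature of `x` is the function `g ↦ exp (⟨x, g⟩ - ‖x‖ ^ 2 / 2)`; the normalization leaves
  -- exactly the cross term of `‖x + y‖ ^ 2 / 2`.
  have hmem : ∀ x : EuclideanSpace ℝ (Fin d),
      MemLp (fun g => Real.exp (inner ℝ x g - ‖x‖ ^ 2 / 2)) 2 γ := by
    intro x
    rw [memLp_two_iff_integrable_sq (by fun_prop)]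
    refine ((hint ((2 : ℝ) • x)).mul_const (Real.exp (-‖x‖ ^ 2))).congr
      (Filter.Eventually.of_forall fun g => ?_)
    simp only [inner_smul_left, ← Real.exp_add, ← Real.exp_nat_mul]
    congr 1; simp; ring
  refine ⟨fun x => (hmem x).toLp, fun x y => ?_⟩
  rw [L2.inner_def]
  have : ∫ g, Real.exp (inner ℝ (x + y) g) * Real.exp (-(‖x‖ ^ 2 / 2) - ‖y‖ ^ 2 / 2) ∂γ
      = Real.exp (inner ℝ x y) := by
    rw [integral_mul_const, hmgf, ← Real.exp_add]
    congr 1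
    rw [norm_add_sq_real]; ring
  rw [← this]
  refine integral_congr_ae ?_
  filter_upwards [(hmem x).coeFn_toLp, (hmem y).coeFn_toLp] with g hx hy
  rw [hx, hy]
  simp only [inner_add_left, ← Real.exp_add, RCLike.inner_apply, conj_trivial]
  congr 1; ring

/-- A feature map of the kernel `exp (⟨x, y⟩ / √d) * ⟨v, w⟩`. -/
theorem exists_softmax_feature (d s : ℕ) :
    ∃ (H : Type) (_ : NormedAddCommGroup H) (_ : InnerProductSpace ℝ H)
      (Φ : EuclideanSpace ℝ (Fin d) → EuclideanSpace ℝ (Fin s) → H),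
      ∀ x v y w, inner ℝ (Φ x v) (Φ y w) =
        Real.exp (inner ℝ x y / Real.sqrt d) * inner ℝ v w := by
  obtain ⟨φ, hφ⟩ := exists_exp_feature d
  -- Scaling both arguments by `d ^ (-1/4)` produces the division by `√d`; the `s` copies of `L²`
  -- realize the tensor product with the value space.
  refine ⟨PiLp 2 (fun _ : Fin s => MeasureTheory.Lp ℝ 2
    (ProbabilityTheory.stdGaussian (EuclideanSpace ℝ (Fin d)))), inferInstance, inferInstance,
    fun x v => WithLp.toLp 2 fun b => v b • φ ((Real.sqrt (Real.sqrt d))⁻¹ • x), ?_⟩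
  intro x v y w
  have h : (Real.sqrt (Real.sqrt d))⁻¹ * (Real.sqrt (Real.sqrt d))⁻¹ = (Real.sqrt d)⁻¹ := by
    rw [← mul_inv, Real.mul_self_sqrt (Real.sqrt_nonneg _)]
  simp only [PiLp.inner_apply, inner_smul_left, inner_smul_right, hφ, conj_trivial,
    RCLike.inner_apply, Finset.mul_sum]
  refine Finset.sum_congr rfl fun b _ => ?_
  rw [div_eq_inv_mul, ← h]
  simp only [Finset.mul_sum, mul_assoc]
  ring

/-! ### Biased coins and outer measures of events -/

/-- Hoeffding's lemma for a sign of probability `p`. -/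
theorem sign_mgf_le {p : ℝ} (h0 : 0 ≤ p) (h1 : p ≤ 1) (x : ℝ) :
    p * Real.exp x + (1 - p) * Real.exp (-x) ≤ Real.exp ((2 * p - 1) * x + x ^ 2 / 2) := by
  set X : Bool → ℝ := fun b => if b then 1 else -1 with hX
  -- This concerns the centred sign: the interval `[-1, 1]` gives variance proxy `1`, and the mean
  -- `2 * p - 1` is put back below.
  have key := ProbabilityTheory.hasSubgaussianMGF_of_mem_Icc (μ := (coin p).toMeasure) (X := X)
    (a := -1) (b := 1) (measurable_of_countable _).aemeasurable
    (Filter.Eventually.of_forall fun b => by cases b <;> simp [hX])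
  have hv : ∀ f : Bool → ℝ, ∫ b, f b ∂(coin p).toMeasure = p * f true + (1 - p) * f false := by
    intro f
    rw [PMF.integral_eq_sum]
    simp [coin, PMF.ofFintype_apply, h0, h1]
  have h := key.mgf_le x
  rw [ProbabilityTheory.mgf, hv, hv] at h
  have e : (2 * p - 1) * x + x ^ 2 / 2 = (2 * p - 1) * x + 1 * x ^ 2 / 2 := by ring
  rw [e, Real.exp_add]
  have hc : ((((‖(1:ℝ) - -1‖₊ / 2) ^ 2 : NNReal)) : ℝ) = 1 := by
    push_cast; norm_num
  rw [hc] at h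
  refine le_trans (le_of_eq ?_) (mul_le_mul_of_nonneg_left h (Real.exp_pos _).le)
  simp only [hX, if_true, Bool.false_eq_true, if_false]
  rw [mul_add, mul_left_comm, ← Real.exp_add, mul_left_comm, ← Real.exp_add]
  congr 3 <;> ring

theorem coin_bind_outerMeasure {α : Type*} {p : ℝ} (h0 : 0 ≤ p) (h1 : p ≤ 1)
    (f : Bool → PMF α) (S : Set α) :
    ((coin p).bind f).toOuterMeasure S =
      ENNReal.ofReal p * (f true).toOuterMeasure S +
        ENNReal.ofReal (1 - p) * (f false).toOuterMeasure S := by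
  rw [PMF.toOuterMeasure_bind_apply, tsum_bool, add_comm]
  simp [coin, PMF.ofFintype_apply, h0, h1]

theorem outerMeasure_univ {α : Type*} (μ : PMF α) : μ.toOuterMeasure Set.univ = 1 :=
  (PMF.toOuterMeasure_apply_eq_one_iff μ _).2 (Set.subset_univ _)

theorem outerMeasure_le_one {α : Type*} (μ : PMF α) (S : Set α) : μ.toOuterMeasure S ≤ 1 :=
  (MeasureTheory.measure_mono (Set.subset_univ S)).trans (outerMeasure_univ μ).le

theorem le_outerMeasure_of_compl {α : Type*} {μ : PMF α} {S : Set α} {δ : ℝ} (hδ : 0 ≤ δ)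
    (h : μ.toOuterMeasure Sᶜ ≤ ENNReal.ofReal δ) :
    ENNReal.ofReal (1 - δ) ≤ μ.toOuterMeasure S := by
  rw [ENNReal.ofReal_sub _ hδ, ENNReal.ofReal_one, tsub_le_iff_right, ← outerMeasure_univ μ,
    ← Set.union_compl_self S]
  exact (MeasureTheory.measure_union_le _ _).trans (add_le_add_right h _)

/-! ### The exponential potential and its budget -/

section Potential

variable {H : Type*} [NormedAddCommGroup H] [InnerProductSpace ℝ H]

/-- The exponential potential of a list of tilted linear functionals. -/
def potential (Θ : List (H × ℝ)) (w : H) : ℝ :=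
  (Θ.map fun p => Real.exp (inner ℝ p.1 w + p.2)).sum

/-- The total mass of a list of tilted linear functionals, for the variance proxy `M`. -/
def budget (M : ℝ) (Θ : List (H × ℝ)) : ℝ :=
  (Θ.map fun p => Real.exp (p.2 + M * ‖p.1‖ ^ 2 / 2)).sum

/-- The effect of a self-balancing step along `u` on a tilted linear functional. -/
def balanceStep (M : ℝ) (u : H) (p : H × ℝ) : H × ℝ :=
  (p.1 - (inner ℝ p.1 u / M) • u, p.2 + inner ℝ p.1 u ^ 2 / 2)

theorem potential_nonneg (Θ : List (H × ℝ)) (w : H) : 0 ≤ potential Θ w :=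
  List.sum_nonneg (by simp only [List.mem_map]; rintro _ ⟨p, _, rfl⟩; positivity)

theorem potential_zero_le_budget {M : ℝ} (hM : 0 ≤ M) (Θ : List (H × ℝ)) :
    potential Θ 0 ≤ budget M Θ := by
  refine List.sum_le_sum fun p _ => Real.exp_le_exp.2 ?_
  rw [inner_zero_right]
  have : 0 ≤ M * ‖p.1‖ ^ 2 / 2 := by positivity
  linarith

/-- With `x = ⟨θ, u⟩`, the step changes `‖θ‖ ^ 2` by `-2 * x ^ 2 / M + (x / M) ^ 2 * ‖u‖ ^ 2 ≤ -x ^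
2 / M`. Multiplied by `M / 2`, this cancels the increase `x ^ 2 / 2` of the tilt. -/
theorem budget_balanceStep_le {M : ℝ} (hM : 0 < M) {u : H} (hu : ‖u‖ ^ 2 ≤ M)
    (Θ : List (H × ℝ)) : budget M (Θ.map (balanceStep M u)) ≤ budget M Θ := by
  unfold budget
  rw [List.map_map]
  refine List.sum_le_sum fun p _ => Real.exp_le_exp.2 ?_
  simp only [balanceStep]
  rw [norm_sub_sq_real, inner_smul_right, norm_smul, mul_pow, Real.norm_eq_abs, sq_abs]
  set x : ℝ := inner ℝ p.1 u
  have h : (x / M) ^ 2 * ‖u‖ ^ 2 ≤ (x / M) ^ 2 * M :=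
    mul_le_mul_of_nonneg_left hu (sq_nonneg _)
  have e1 : (x / M) ^ 2 * M = x ^ 2 / M := by field_simp
  have e2 : x / M * x = x ^ 2 / M := by ring
  have e3 : M * (x ^ 2 / M) = x ^ 2 := by field_simp
  rw [e2]
  rw [e1] at h
  nlinarith [mul_le_mul_of_nonneg_left h hM.le]

/-- The sign has mean `-⟨w, u⟩ / M`, so the linear term in Hoeffding's lemma is `-⟨w, u⟩ * ⟨θ, u⟩ /
M`, which is absorbed into `θ`; the quadratic term goes into the tilt. The bound on `|⟨w, u⟩|` makes
the bias a probability. -/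
theorem potential_balance_le {M : ℝ} (hM : 0 < M) {u w : H} (hw : |inner ℝ w u| ≤ M)
    (Θ : List (H × ℝ)) :
    (1 / 2 - inner ℝ w u / (2 * M)) * potential Θ (w + u) +
        (1 - (1 / 2 - inner ℝ w u / (2 * M))) * potential Θ (w - u) ≤
      potential (Θ.map (balanceStep M u)) w := by
  unfold potential
  rw [List.map_map, ← List.sum_map_mul_left, ← List.sum_map_mul_left, ← List.sum_map_add]
  refine List.sum_le_sum fun p _ => ?_
  set q : ℝ := 1 / 2 - inner ℝ w u / (2 * M) with hq
  have habs := abs_le.1 hw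
  have hd : inner ℝ w u / (2 * M) ≤ 1 / 2 := by
    rw [div_le_iff₀ (by positivity)]; linarith
  have hd' : -(1 / 2) ≤ inner ℝ w u / (2 * M) := by
    rw [le_div_iff₀ (by positivity)]; linarith
  have key := sign_mgf_le (p := q) (by linarith) (by linarith) (inner ℝ p.1 u)
  have h := mul_le_mul_of_nonneg_left key (Real.exp_pos (inner ℝ p.1 w + p.2)).le
  rw [← Real.exp_add] at h
  refine le_trans (le_of_eq ?_) (h.trans (le_of_eq ?_))
  · rw [mul_add, mul_left_comm, ← Real.exp_add, mul_left_comm, ← Real.exp_add,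
      inner_add_right, inner_sub_right]
    congr 3 <;> ring
  · simp only [Function.comp, balanceStep, inner_sub_left, inner_smul_left, conj_trivial]
    rw [real_inner_comm w u]
    congr 1
    rw [hq]
    field_simp
    ring

end Potential

/-! ### The walk in feature space and its backward analysis -/

namespace SoftmaxBalance

variable {d s n : ℕ} {H : Type*} [NormedAddCommGroup H] [InnerProductSpace ℝ H]

/-- Unprocessed indices have sign `0`, so neither the diagonal term of the sum over `Iic j` nor the
later indices contribute. -/
theorem correlation_eq_inner {k : Fin n → EuclideanSpace ℝ (Fin d)}
    {v : Fin n → EuclideanSpace ℝ (Fin s)} {U : Fin n → H}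
    (hU : ∀ i j, inner ℝ (U i) (U j) =
      Real.exp (inner ℝ (k i) (k j) / Real.sqrt d) * inner ℝ (v i) (v j))
    {η : Fin n → ℝ} {j : Fin n} (hη : ∀ i, η i ≠ 0 → i < j) :
    correlation k v η j = inner ℝ (∑ i, η i • U i) (U j) := by
  rw [sum_inner, correlation, ← Finset.sum_subset (Finset.subset_univ (Finset.Iic j))]
  · refine Finset.sum_congr rfl fun i _ => ?_
    rw [inner_smul_left, hU, mul_comm]
    simp
  · intro i _ hi
    have : η i = 0 := by
      by_contra h
      exact hi (Finset.mem_Iic.2 (hη i h).le)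
    simp [this]

theorem sum_update_smul {U : Fin n → H} {η : Fin n → ℝ} {j : Fin n} (hη : η j = 0) (x : ℝ) :
    ∑ i, Function.update η j x i • U i = ∑ i, η i • U i + x • U j := by
  rw [← Finset.add_sum_erase _ _ (Finset.mem_univ j),
    ← Finset.add_sum_erase _ (fun i => η i • U i) (Finset.mem_univ j), hη]
  simp only [Function.update_self, zero_smul, zero_add]
  rw [add_comm]
  congr 1
  refine Finset.sum_congr rfl fun i hi => ?_
  rw [Function.update_of_ne (Finset.ne_of_mem_erase hi)]

/-- Failures of the self-balancing walk, and bad final positions that are detected by an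
exponential potential, are controlled by an exponential potential of the current position. -/
theorem exists_potential {k : Fin n → EuclideanSpace ℝ (Fin d)}
    {v : Fin n → EuclideanSpace ℝ (Fin s)} {U : Fin n → H}
    (hU : ∀ i j, inner ℝ (U i) (U j) =
      Real.exp (inner ℝ (k i) (k j) / Real.sqrt d) * inner ℝ (v i) (v j))
    {c R : ℝ} (hR : 0 < R) (hc : 1 ≤ c) (hUR : ∀ i, ‖U i‖ ≤ R)
    (B : Set (Option (Fin n → ℝ))) (Θ₀ : List (H × ℝ))
    (hB : ∀ η, some η ∈ B → 1 ≤ potential Θ₀ (∑ i, η i • U i)) (l : List (Fin n))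
    (hl : l.Pairwise (· < ·)) :
    ∃ Θ : List (H × ℝ),
      budget (c * R ^ 2) Θ ≤ budget (c * R ^ 2) Θ₀ + l.length * (2 * Real.exp (-c / 2)) ∧
      ∀ η : Fin n → ℝ, (∀ i, η i ≠ 0 → ∀ j ∈ l, i < j) →
        (signs k v c R l η).toOuterMeasure B ≤
          ENNReal.ofReal (potential Θ (∑ i, η i • U i)) := by
  have hM : 0 < c * R ^ 2 := by positivity
  -- The induction runs backwards from the last round. `Θ` depends only on the remaining list and
  -- not on `η`, so one `Θ` serves both outcomes of the coin.
  induction l with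
  | nil =>
    refine ⟨Θ₀, by simp, fun η _ => ?_⟩
    rw [signs, PMF.toOuterMeasure_pure_apply]
    split_ifs with h
    · rw [← ENNReal.ofReal_one]
      exact ENNReal.ofReal_le_ofReal (hB η h)
    · exact zero_le
  | cons j l ih =>
    obtain ⟨hjl, hl'⟩ := List.pairwise_cons.1 hl
    obtain ⟨Θ, hΘ, hP⟩ := ih hl'
    set M := c * R ^ 2 with hMdef
    have hu2 : ‖U j‖ ^ 2 ≤ R ^ 2 := pow_le_pow_left₀ (norm_nonneg _) (hUR j) 2
    have hu : ‖U j‖ ^ 2 ≤ M := hu2.trans (le_mul_of_one_le_left (by positivity) hc)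
    -- Each failure functional has `M * ‖θ‖ ^ 2 ≤ c`, so with tilt `-c` its budget is at most `exp
    -- (-c / 2)`.
    have hn : c + -c + M * ‖(1 / R ^ 2) • U j‖ ^ 2 / 2 ≤ c / 2 := by
      rw [norm_smul, mul_pow, Real.norm_eq_abs, sq_abs]
      have e : M * ((1 / R ^ 2) ^ 2 * ‖U j‖ ^ 2) = c * (‖U j‖ ^ 2 / R ^ 2) := by
        rw [hMdef]; field_simp
      rw [e]
      have : ‖U j‖ ^ 2 / R ^ 2 ≤ 1 := div_le_one_of_le₀ hu2 (by positivity)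
      nlinarith
    -- If the round fails, one of the two new exponentials is at least `1`; if not, the pulled-back
    -- list dominates the average over the coin.
    refine ⟨((1 / R ^ 2) • U j, -c) :: (-((1 / R ^ 2) • U j), -c) ::
      Θ.map (balanceStep M (U j)), ?_, ?_⟩
    · have h1 := (budget_balanceStep_le hM hu Θ).trans hΘ
      have h2 : Real.exp (-c + M * ‖(1 / R ^ 2) • U j‖ ^ 2 / 2) ≤ Real.exp (-c / 2) :=
        Real.exp_le_exp.2 (by linarith)
      simp only [budget, List.map_cons, List.sum_cons, norm_neg] at h1 h2 ⊢
      simp only [List.length_cons, Nat.cast_add, Nat.cast_one]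
      linarith
    · intro η hη
      have hηj : η j = 0 := by
        by_contra h
        exact lt_irrefl j (hη j h j (by simp))
      have hcorr := correlation_eq_inner hU (j := j) fun i hi => hη i hi j (by simp)
      set w := ∑ i, η i • U i with hw
      have hpot : potential (((1 / R ^ 2) • U j, -c) :: (-((1 / R ^ 2) • U j), -c) ::
          Θ.map (balanceStep M (U j))) w =
          Real.exp (inner ℝ w (U j) / R ^ 2 - c) + (Real.exp (-(inner ℝ w (U j) / R ^ 2) - c) +
            potential (Θ.map (balanceStep M (U j))) w) := by
        simp only [potential, List.map_cons, List.sum_cons, inner_neg_left, inner_smul_left,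
          conj_trivial, real_inner_comm w (U j)]
        congr 2
        · congr 1; ring
        · congr 1; ring
      rw [hpot, signs, hcorr]
      have hp0 := potential_nonneg (Θ.map (balanceStep M (U j))) w
      split_ifs with hfail
      · refine le_trans (outerMeasure_le_one _ _) ?_
        rw [← ENNReal.ofReal_one]
        refine ENNReal.ofReal_le_ofReal ?_
        rcases lt_abs.1 hfail with h | h
        · have : 1 ≤ Real.exp (inner ℝ w (U j) / R ^ 2 - c) :=
            Real.one_le_exp (by rw [sub_nonneg, le_div_iff₀ (by positivity)]; exact h.le)
          linarith [Real.exp_pos (inner ℝ w (U j) / R ^ 2 - c),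
            Real.exp_pos (-(inner ℝ w (U j) / R ^ 2) - c)]
        · have : 1 ≤ Real.exp (-(inner ℝ w (U j) / R ^ 2) - c) :=
            Real.one_le_exp (by
              rw [sub_nonneg, ← neg_div, le_div_iff₀ (by positivity)]; exact h.le)
          linarith [Real.exp_pos (inner ℝ w (U j) / R ^ 2 - c),
            Real.exp_pos (-(inner ℝ w (U j) / R ^ 2) - c)]
      · have hle : |inner ℝ w (U j)| ≤ M := not_lt.1 hfail
        have habs := abs_le.1 hle
        have hd : inner ℝ w (U j) / (2 * M) ≤ 1 / 2 := by
          rw [div_le_iff₀ (by positivity)]; linarith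
        have hd' : -(1 / 2) ≤ inner ℝ w (U j) / (2 * M) := by
          rw [le_div_iff₀ (by positivity)]; linarith
        rw [mul_assoc 2 c, ← hMdef, coin_bind_outerMeasure (by linarith) (by linarith)]
        have hinv : ∀ x : ℝ, ∀ i, Function.update η j x i ≠ 0 → ∀ j' ∈ l, i < j' := by
          intro x i hi j' hj'
          by_cases hij : i = j
          · exact hij ▸ hjl j' hj'
          · rw [Function.update_of_ne hij] at hi
            exact hη i hi j' (List.mem_cons_of_mem _ hj')
        have ht := hP _ (hinv 1)
        have hf := hP _ (hinv (-1))
        rw [sum_update_smul hηj, one_smul] at ht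
        rw [sum_update_smul hηj, neg_one_smul, ← sub_eq_add_neg] at hf
        simp only [if_true, Bool.false_eq_true, if_false]
        refine (add_le_add (mul_le_mul_right ht _) (mul_le_mul_right hf _)).trans ?_
        rw [← ENNReal.ofReal_mul (by linarith), ← ENNReal.ofReal_mul (by linarith),
          ← ENNReal.ofReal_add
            (mul_nonneg (by linarith) (potential_nonneg _ _))
            (mul_nonneg (by linarith) (potential_nonneg _ _))]
        refine ENNReal.ofReal_le_ofReal ((potential_balance_le hM hle Θ).trans ?_)
        have := Real.exp_pos (inner ℝ w (U j) / R ^ 2 - c)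
        have := Real.exp_pos (-(inner ℝ w (U j) / R ^ 2) - c)
        linarith

end SoftmaxBalance
-- Outcomes of the walk and the balancing guarantee
namespace SoftmaxBalance

variable {d s n : ℕ}

theorem signs_support {k : Fin n → EuclideanSpace ℝ (Fin d)}
    {v : Fin n → EuclideanSpace ℝ (Fin s)} {c R : ℝ} {l : List (Fin n)} (hl : l.Nodup)
    {η η' : Fin n → ℝ} (h : some η' ∈ (signs k v c R l η).support) (i : Fin n) :
    (i ∈ l → η' i = 1 ∨ η' i = -1) ∧ (i ∉ l → η' i = η i) := by
  induction l generalizing η with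
  | nil =>
    simp only [signs, PMF.support_pure, Set.mem_singleton_iff, Option.some.injEq] at h
    simp [h]
  | cons j l ih =>
    rw [signs] at h
    split_ifs at h with hf
    · simp at h
    · obtain ⟨hj, hl'⟩ := List.nodup_cons.1 hl
      rw [PMF.mem_support_bind_iff] at h
      obtain ⟨b, -, hb⟩ := h
      obtain ⟨h1, h2⟩ := ih hl' hb
      constructor
      · intro hi
        by_cases hil : i ∈ l
        · exact h1 hil
        · have hij : i = j := (List.mem_cons.1 hi).resolve_right hil
          rw [h2 hil, hij, Function.update_self]
          cases b <;> simp
      · intro hi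
        rw [List.mem_cons, not_or] at hi
        rw [h2 hi.2, Function.update_of_ne hi.1]

/-- Serves the degenerate inputs. The threshold is only assumed to hold for sign vectors supported
before `j`, which are the only ones met when the list is increasing. -/
theorem none_notMem_support_signs {k : Fin n → EuclideanSpace ℝ (Fin d)}
    {v : Fin n → EuclideanSpace ℝ (Fin s)} {c R : ℝ}
    (hcR : ∀ (η : Fin n → ℝ) (j : Fin n), (∀ i, η i ≠ 0 → i < j) →
      |correlation k v η j| ≤ c * R ^ 2)
    {l : List (Fin n)} (hl : l.Pairwise (· < ·)) {η : Fin n → ℝ}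
    (hη : ∀ i, η i ≠ 0 → ∀ j ∈ l, i < j) : none ∉ (signs k v c R l η).support := by
  induction l generalizing η with
  | nil => simp [signs]
  | cons j l ih =>
    obtain ⟨hjl, hl'⟩ := List.pairwise_cons.1 hl
    rw [signs, if_neg (not_lt.2 (hcR η j fun i hi => hη i hi j (by simp)))]
    rw [PMF.mem_support_bind_iff]
    rintro ⟨b, -, hb⟩
    refine ih hl' ?_ hb
    intro i hi j' hj'
    by_cases hij : i = j
    · exact hij ▸ hjl j' hj'
    · rw [Function.update_of_ne hij] at hi
      exact hη i hi j' (List.mem_cons_of_mem _ hj')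

theorem two_mul_card_select_le (η : Fin n → ℝ) : 2 * (select η).card ≤ n := by
  have hd : Disjoint (Finset.univ.filter fun i => η i = 1)
      (Finset.univ.filter fun i => η i = -1) := by
    rw [Finset.disjoint_filter]
    intro i _ h1 h2
    rw [h1] at h2
    norm_num at h2
  have h := Finset.card_le_univ ((Finset.univ.filter fun i => η i = 1) ∪
      (Finset.univ.filter fun i => η i = -1))
  rw [Finset.card_union_of_disjoint hd, Fintype.card_fin] at h
  unfold select
  split_ifs <;> omega

theorem card_le_of_mem_support_law {k : Fin n → EuclideanSpace ℝ (Fin d)}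
    {v : Fin n → EuclideanSpace ℝ (Fin s)} {rK rV δ : ℝ} {S : Finset (Fin n)}
    (h : some S ∈ (law k v rK rV δ).support) : (S.card : ℝ) ≤ (n : ℝ) / 2 := by
  rw [law, PMF.support_map] at h
  obtain ⟨o, -, ho⟩ := h
  cases o with
  | none => simp at ho
  | some η =>
    simp only [Option.map_some, Option.some.injEq] at ho
    have := two_mul_card_select_le η
    rw [ho] at this
    rw [le_div_iff₀ two_pos, mul_comm]
    exact_mod_cast this

/-- Which of the two classes is selected affects the difference only by a sign. -/
theorem norm_expSum_select (k : Fin n → EuclideanSpace ℝ (Fin d))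
    (v : Fin n → EuclideanSpace ℝ (Fin s)) (q : EuclideanSpace ℝ (Fin d)) {η : Fin n → ℝ}
    (hη : ∀ i, η i = 1 ∨ η i = -1) :
    ‖expSum k v q (select η) - expSum k v q (select η)ᶜ‖ =
      ‖∑ i, η i • Real.exp (inner ℝ (k i) q / Real.sqrt d) • v i‖ := by
  set x : Fin n → EuclideanSpace ℝ (Fin s) :=
    fun i => Real.exp (inner ℝ (k i) q / Real.sqrt d) • v i
  have hc : (Finset.univ.filter fun i => η i = 1)ᶜ = Finset.univ.filter fun i => η i = -1 := by
    ext i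
    rcases hη i with h | h <;> simp [h] <;> norm_num
  have hsum : ∑ i, η i • x i =
      ∑ i ∈ Finset.univ.filter (fun i => η i = 1), x i -
        ∑ i ∈ Finset.univ.filter (fun i => η i = -1), x i := by
    rw [← hc, ← Finset.sum_add_sum_compl (Finset.univ.filter fun i => η i = 1), sub_eq_add_neg,
      ← Finset.sum_neg_distrib]
    congr 1
    · refine Finset.sum_congr rfl fun i hi => ?_
      rw [(Finset.mem_filter.1 hi).2, one_smul]
    · rw [hc]
      refine Finset.sum_congr rfl fun i hi => ?_
      rw [(Finset.mem_filter.1 hi).2, neg_one_smul]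
  rw [hsum]
  unfold expSum select
  split_ifs
  · rw [hc]
  · rw [← hc, compl_compl, norm_sub_rev]

theorem norm_le_sqrt_mul {x : EuclideanSpace ℝ (Fin s)} {T : ℝ} (hT : 0 ≤ T)
    (h : ∀ b, |x b| ≤ T) : ‖x‖ ≤ Real.sqrt s * T := by
  rw [EuclideanSpace.norm_eq, ← Real.sqrt_sq hT, ← Real.sqrt_mul (by positivity)]
  refine Real.sqrt_le_sqrt ?_
  calc ∑ b, ‖x b‖ ^ 2 ≤ ∑ _b : Fin s, T ^ 2 :=
        Finset.sum_le_sum fun b _ => pow_le_pow_left₀ (norm_nonneg _) (h b) 2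
    _ = s * T ^ 2 := by simp

theorem exp_inner_div_le (d : ℕ) {E : Type*} [NormedAddCommGroup E] [InnerProductSpace ℝ E]
    (x y : E) : Real.exp (inner ℝ x y / Real.sqrt d) ≤
      Real.exp (‖x‖ ^ 2 / (2 * Real.sqrt d)) * Real.exp (‖y‖ ^ 2 / (2 * Real.sqrt d)) := by
  rw [← Real.exp_add, ← add_div, mul_comm 2, ← div_div, div_right_comm]
  refine Real.exp_le_exp.2 (div_le_div_of_nonneg_right ?_ (Real.sqrt_nonneg _))
  have := real_inner_le_norm x y
  nlinarith [sq_nonneg (‖x‖ - ‖y‖)]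

theorem scale_nonneg {rK rV : ℝ} (h : 0 ≤ rV) : 0 ≤ scale d rK rV :=
  mul_nonneg (Real.exp_pos _).le h

theorem exp_norm_mul_norm_le_scale {x : EuclideanSpace ℝ (Fin d)} {w : EuclideanSpace ℝ (Fin s)}
    {rK rV : ℝ} (hx : ‖x‖ ≤ rK) (hw : ‖w‖ ≤ rV) :
    Real.exp (‖x‖ ^ 2 / (2 * Real.sqrt d)) * ‖w‖ ≤ scale d rK rV := by
  unfold scale
  gcongr

/-- The balancing guarantee in the case in which the walk cannot fail. -/
theorem guarantee_of_no_failure {k : Fin n → EuclideanSpace ℝ (Fin d)}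
    {v : Fin n → EuclideanSpace ℝ (Fin s)} {rK rV δ : ℝ} (hK : ∀ j, ‖k j‖ ≤ rK)
    (hV : ∀ j, ‖v j‖ ≤ rV) (hδ : 0 ≤ δ) (q : EuclideanSpace ℝ (Fin d)) {A : ℝ}
    (hA : n * (Real.exp (‖q‖ ^ 2 / (2 * Real.sqrt d)) * scale d rK rV) ≤ A)
    (hcR : ∀ (η : Fin n → ℝ) (j : Fin n), (∀ i, η i ≠ 0 → i < j) →
      |correlation k v η j| ≤ threshold n δ * scale d rK rV ^ 2) :
    ENNReal.ofReal (1 - δ) ≤ (law k v rK rV δ).toOuterMeasure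
      {o | ∃ S : Finset (Fin n), o = some S ∧
        ‖expSum k v q S - expSum k v q Sᶜ‖ ≤ A} := by
  have : (law k v rK rV δ).toOuterMeasure {o | ∃ S : Finset (Fin n), o = some S ∧
        ‖expSum k v q S - expSum k v q Sᶜ‖ ≤ A} = 1 := by
    rw [PMF.toOuterMeasure_apply_eq_one_iff, law, PMF.support_map]
    rintro _ ⟨o, ho, rfl⟩
    cases o with
    | none =>
      exact absurd ho (none_notMem_support_signs hcR (List.pairwise_lt_finRange n) (by simp))
    | some η =>
      have hη := fun i => (signs_support (List.nodup_finRange n) ho i).1 (List.mem_finRange i)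
      refine ⟨select η, rfl, ?_⟩
      rw [norm_expSum_select k v q hη]
      refine (norm_sum_le _ _).trans (le_trans ?_ hA)
      refine (Finset.sum_le_card_nsmul _ _
        (Real.exp (‖q‖ ^ 2 / (2 * Real.sqrt d)) * scale d rK rV) fun i _ => ?_).trans (by simp)
      have h1 : ‖η i‖ = 1 := by rcases hη i with h | h <;> simp [h]
      rw [norm_smul, h1, one_mul, norm_smul, Real.norm_eq_abs, abs_of_pos (Real.exp_pos _)]
      calc _ ≤ _ := mul_le_mul_of_nonneg_right (exp_inner_div_le d (k i) q) (norm_nonneg _)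
        _ = Real.exp (‖q‖ ^ 2 / (2 * Real.sqrt d)) *
            (Real.exp (‖k i‖ ^ 2 / (2 * Real.sqrt d)) * ‖v i‖) := by ring
        _ ≤ _ := mul_le_mul_of_nonneg_left (exp_norm_mul_norm_le_scale (hK i) (hV i))
            (Real.exp_pos _).le
  rw [this]
  exact ENNReal.ofReal_le_one.2 (by linarith)

/-- The self-balancing walk rarely fails and rarely ends up with a large signed sum. -/
theorem signs_tail {k : Fin n → EuclideanSpace ℝ (Fin d)}
    {v : Fin n → EuclideanSpace ℝ (Fin s)} {rK c R : ℝ} {rV : ℝ} (hK : ∀ j, ‖k j‖ ≤ rK)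
    (hV : ∀ j, ‖v j‖ ≤ rV) (hRdef : R = scale d rK rV) (hR : 0 < R) (hc : 1 ≤ c) (τ : ℝ)
    (q : EuclideanSpace ℝ (Fin d)) :
    (signs k v c R (List.finRange n) 0).toOuterMeasure
        {o | o = none ∨ ∃ η, o = some η ∧ ∃ b,
          τ * (Real.exp (‖q‖ ^ 2 / (2 * Real.sqrt d)) * R) <
            |(∑ i, η i • Real.exp (inner ℝ (k i) q / Real.sqrt d) • v i) b|} ≤
      ENNReal.ofReal (s * (2 * Real.exp (c / 2 - τ)) + n * (2 * Real.exp (-c / 2))) := by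
  obtain ⟨H, _, _, Φ, hΦ⟩ := exists_softmax_feature d s
  have hnorm : ∀ x w, ‖Φ x w‖ = Real.exp (‖x‖ ^ 2 / (2 * Real.sqrt d)) * ‖w‖ := by
    intro x w
    rw [← sq_eq_sq₀ (norm_nonneg _) (by positivity), ← real_inner_self_eq_norm_sq, hΦ,
      real_inner_self_eq_norm_sq, real_inner_self_eq_norm_sq, mul_pow, ← Real.exp_nat_mul]
    congr 2
    push_cast
    rw [← div_div]; ring
  set U : Fin n → H := fun i => Φ (k i) (v i) with hUdef
  have hUR : ∀ i, ‖U i‖ ≤ R := fun i => by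
    rw [hUdef, hRdef, hnorm]
    exact exp_norm_mul_norm_le_scale (hK i) (hV i)
  set Q := Real.exp (‖q‖ ^ 2 / (2 * Real.sqrt d)) with hQ
  have hQ0 : 0 < Q := Real.exp_pos _
  -- These functionals read off the coordinates of the signed sum. The normalization to length `1 /
  -- R` turns `M * ‖ψ b‖ ^ 2 / 2` into `c / 2`.
  set ψ : Fin s → H := fun b => (1 / (Q * R)) • Φ q (EuclideanSpace.single b 1) with hψ
  have hψn : ∀ b, ‖ψ b‖ = 1 / R := by
    intro b
    rw [hψ, norm_smul, hnorm, PiLp.norm_single, norm_one, mul_one, ← hQ,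
      Real.norm_eq_abs, abs_of_pos (by positivity)]
    field_simp
  have hψi : ∀ (b : Fin s) (η : Fin n → ℝ), inner ℝ (ψ b) (∑ i, η i • U i) =
      (∑ i, η i • Real.exp (inner ℝ (k i) q / Real.sqrt d) • v i) b / (Q * R) := by
    intro b η
    rw [inner_sum, WithLp.ofLp_sum, Finset.sum_apply, Finset.sum_div]
    refine Finset.sum_congr rfl fun i _ => ?_
    rw [hψ, hUdef, inner_smul_right, inner_smul_left, hΦ, EuclideanSpace.inner_single_left,
      real_inner_comm]
    simp
    ring
  set Θ₀ : List (H × ℝ) := (List.finRange s).map (fun b => (ψ b, -τ)) ++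
    (List.finRange s).map (fun b => (-ψ b, -τ)) with hΘ
  have hbudget : budget (c * R ^ 2) Θ₀ = s * (2 * Real.exp (c / 2 - τ)) := by
    have e : ∀ b, Real.exp (-τ + c * R ^ 2 * ‖ψ b‖ ^ 2 / 2) = Real.exp (c / 2 - τ) := by
      intro b
      rw [hψn]
      congr 1
      field_simp
      ring
    simp only [budget, hΘ, List.map_append, List.map_map, List.sum_append, Function.comp_def,
      norm_neg, e, List.map_const', List.sum_replicate, List.length_finRange, nsmul_eq_mul]
    ring
  set B : Set (Option (Fin n → ℝ)) := {o | o = none ∨ ∃ η, o = some η ∧ ∃ b, τ * (Q * R) <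
      |(∑ i, η i • Real.exp (inner ℝ (k i) q / Real.sqrt d) • v i) b|} with hBdef
  have hB : ∀ η, some η ∈ B → 1 ≤ potential Θ₀ (∑ i, η i • U i) := by
    rintro η (h | ⟨η', h, b, hb⟩)
    · simp at h
    · obtain rfl : η = η' := by simpa using h
      have hmem : ∀ p ∈ Θ₀, Real.exp (inner ℝ p.1 (∑ i, η i • U i) + p.2) ≤
          potential Θ₀ (∑ i, η i • U i) := by
        intro p hp
        refine List.single_le_sum ?_ _ (List.mem_map.2 ⟨p, hp, rfl⟩)
        simp only [List.mem_map]
        rintro _ ⟨p, _, rfl⟩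
        positivity
      rcases lt_abs.1 hb with h | h
      · refine le_trans (Real.one_le_exp ?_) (hmem (ψ b, -τ) (by simp [hΘ]))
        rw [hψi, ← sub_eq_add_neg, sub_nonneg, le_div_iff₀ (by positivity)]
        exact h.le
      · refine le_trans (Real.one_le_exp ?_) (hmem (-ψ b, -τ) (by simp [hΘ]))
        rw [inner_neg_left, hψi, ← sub_eq_add_neg, sub_nonneg, ← neg_div,
          le_div_iff₀ (by positivity)]
        exact h.le
  obtain ⟨Θ, hΘb, hP⟩ := exists_potential (k := k) (v := v) (U := U)
    (fun i j => hΦ _ _ _ _) hR hc hUR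
    B Θ₀ hB
    (List.finRange n) (List.pairwise_lt_finRange n)
  refine (hP 0 (by simp)).trans (ENNReal.ofReal_le_ofReal ?_)
  simp only [Pi.zero_apply, zero_smul, Finset.sum_const_zero]
  refine (potential_zero_le_budget (by positivity) Θ).trans (hΘb.trans ?_)
  rw [hbudget, List.length_finRange]

/-- A union bound over `2 * s` coordinate functionals and `2 * n` failure functionals. The cases `1
≤ δ`, `R = 0` and `n = 1` are separate, because `signs_tail` needs `0 < R` and `1 ≤ c`. -/
theorem guarantee {k : Fin n → EuclideanSpace ℝ (Fin d)}
    {v : Fin n → EuclideanSpace ℝ (Fin s)} {rK rV δ : ℝ} (hK : ∀ j, ‖k j‖ ≤ rK)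
    (hV : ∀ j, ‖v j‖ ≤ rV) (hδ : 0 < δ) (hn : 0 < n) (hs : 0 < s)
    (hns : 2 * δ ≤ (n : ℝ) * s) (q : EuclideanSpace ℝ (Fin d)) {A : ℝ}
    (hA : 18 * (Real.sqrt s * Real.log (n * s / δ) *
      (Real.exp (‖q‖ ^ 2 / (2 * Real.sqrt d)) * scale d rK rV)) ≤ A) :
    ENNReal.ofReal (1 - δ) ≤ (law k v rK rV δ).toOuterMeasure
      {o | ∃ S : Finset (Fin n), o = some S ∧
        ‖expSum k v q S - expSum k v q Sᶜ‖ ≤ A} := by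
  rcases le_or_gt 1 δ with hδ1 | hδ1
  · rw [ENNReal.ofReal_of_nonpos (by linarith)]
    exact zero_le
  set Q := Real.exp (‖q‖ ^ 2 / (2 * Real.sqrt d)) with hQ
  have hQ0 : 0 < Q := Real.exp_pos _
  have hrV : 0 ≤ rV := (norm_nonneg (v ⟨0, hn⟩)).trans (hV _)
  set R := scale d rK rV with hRdef
  have hR0 : 0 ≤ R := scale_nonneg hrV
  have hs1 : (1 : ℝ) ≤ s := by exact_mod_cast hs
  have hn1 : (1 : ℝ) ≤ n := by exact_mod_cast hn
  have hlog2 := Real.log_two_gt_d9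
  set X := Real.log (n * s / δ) with hX
  have hXlog : Real.log 2 ≤ X :=
    Real.log_le_log two_pos (by rw [le_div_iff₀ hδ]; exact hns)
  have hsq : 1 ≤ Real.sqrt s := Real.one_le_sqrt.2 hs1
  have hlogn : 0 ≤ Real.log (n / δ) :=
    Real.log_nonneg (by rw [le_div_iff₀ hδ]; linarith)
  rcases hR0.eq_or_lt with hRz | hRpos
  · have hv : ∀ j, v j = 0 := by
      intro j
      have : rV = 0 := by
        rcases mul_eq_zero.1 hRz.symm with h | h
        · exact absurd h (Real.exp_pos _).ne'
        · exact h
      exact norm_le_zero_iff.1 (this ▸ hV j)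
    refine guarantee_of_no_failure hK hV hδ.le q ?_ ?_
    · rw [← hRdef, ← hRz]
      rw [← hRz] at hA
      simpa using hA
    · intro η j _
      simp only [correlation, hv, inner_zero_left, mul_zero, zero_mul, Finset.sum_const_zero,
        abs_zero, threshold]
      positivity
  -- For `n = 1` the threshold can be arbitrarily close to `0`, but the only correlation vanishes
  -- and the trivial bound suffices.
  rcases (Nat.succ_le_of_lt hn).eq_or_lt with hn' | hn2
  · refine guarantee_of_no_failure hK hV hδ.le q ?_ ?_
    · rw [← hn', ← hRdef, ← hQ]
      refine le_trans ?_ hA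
      have : 1 ≤ 18 * (Real.sqrt s * X) := by nlinarith
      have hQR : 0 < Q * R := by positivity
      push_cast
      nlinarith
    · intro η j hη
      have h0 : ∀ i, η i = 0 := by
        intro i
        by_contra h
        have := hη i h
        have := i.2
        have := j.2
        omega
      simp only [correlation, h0, mul_zero, Finset.sum_const_zero, abs_zero, threshold]
      positivity
  have hn2' : (2 : ℝ) ≤ n := by exact_mod_cast hn2
  have hnδ : 2 ≤ n / δ := by rw [le_div_iff₀ hδ]; linarith
  have hlogn2 : Real.log 2 ≤ Real.log (n / δ) := Real.log_le_log two_pos hnδ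
  set c := threshold n δ with hcdef
  have hc : c = 30 * Real.log (n / δ) := rfl
  have hc1 : 1 ≤ c := by rw [hc]; linarith
  -- Chosen so that the coordinate functionals contribute exactly `δ / 2`. The constant `18` is `15`
  -- from `c / 2` plus `3` from the logarithm.
  set τ := c / 2 + Real.log (4 * s / δ) with hτ
  have hτle : τ ≤ 18 * X := by
    have h1 : Real.log (n / δ) ≤ X := by
      refine Real.log_le_log (by positivity) ?_
      rw [div_le_div_iff_of_pos_right hδ]
      nlinarith
    have h2 : Real.log (4 * s / δ) ≤ 3 * X := by
      have e : Real.log (4 * (n * s / δ)) = 2 * Real.log 2 + X := by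
        rw [Real.log_mul (by norm_num) (by positivity)]
        congr 1
        rw [show (4 : ℝ) = 2 ^ 2 by norm_num, Real.log_pow]
        norm_num
      have : Real.log (4 * s / δ) ≤ Real.log (4 * (n * s / δ)) := by
        refine Real.log_le_log (by positivity) ?_
        rw [← mul_div_assoc, div_le_div_iff_of_pos_right hδ]
        nlinarith
      linarith
    rw [hτ, hc]; linarith
  have hτ0 : 0 ≤ τ := by
    have : 0 ≤ Real.log (4 * s / δ) :=
      Real.log_nonneg (by rw [le_div_iff₀ hδ]; nlinarith)
    linarith
  refine le_outerMeasure_of_compl hδ.le ?_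
  rw [law, PMF.toOuterMeasure_map_apply]
  -- The inclusion of events is needed only on the support, where all signs are `1` or `-1`.
  refine (PMF.toOuterMeasure_mono (signs _ _ _ _ _ _) ?_).trans
    ((signs_tail hK hV hRdef hRpos hc1 τ q).trans (ENNReal.ofReal_le_ofReal ?_))
  · rintro o ⟨ho, hsupp⟩
    cases o with
    | none => exact Or.inl rfl
    | some η =>
      refine Or.inr ⟨η, rfl, ?_⟩
      by_contra! hb
      have hη := fun i => (signs_support (List.nodup_finRange n) hsupp i).1 (List.mem_finRange i)
      refine ho ⟨select η, rfl, ?_⟩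
      rw [norm_expSum_select k v q hη]
      refine (norm_le_sqrt_mul (by positivity) hb).trans (le_trans ?_ hA)
      have hQR : 0 < Q * R := by positivity
      calc Real.sqrt s * (τ * (Q * R)) ≤ Real.sqrt s * (18 * X * (Q * R)) := by gcongr
        _ = _ := by ring
  · have e1 : Real.exp (c / 2 - τ) = δ / (4 * s) := by
      rw [hτ, sub_add_cancel_left, Real.exp_neg, Real.exp_log (by positivity), inv_div]
    have e2 : Real.exp (-c / 2) = (δ / n) ^ 15 := by
      have : -c / 2 = ((15 : ℕ) : ℝ) * Real.log (δ / n) := by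
        rw [hc, ← inv_div (n : ℝ) δ, Real.log_inv]
        push_cast; ring
      rw [this, Real.exp_nat_mul, Real.exp_log (by positivity)]
    rw [e1, e2]
    -- All failures together cost `2 * n * (δ / n) ^ 15`; one factor `δ / n` cancels `n`, and the
    -- other `14` make the result far smaller than `δ / 2`.
    have h3 : (δ / n) ^ 14 ≤ (1 / 2) ^ 14 := by
      refine pow_le_pow_left₀ (by positivity) ?_ 14
      rw [div_le_div_iff₀ (by positivity) two_pos]
      linarith
    have e3 : (n : ℝ) * (2 * (δ / n) ^ 15) = 2 * δ * (δ / n) ^ 14 := by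
      rw [pow_succ]; field_simp
    have e4 : (s : ℝ) * (2 * (δ / (4 * s))) = δ / 2 := by field_simp; norm_num
    rw [e3, e4]
    nlinarith

end SoftmaxBalance

/-! ### Couplings -/

/-- The distributions `μ` and `ν` have a coupling that is supported on the relation `r`. -/
def Coupled {α β : Type*} (μ : PMF α) (ν : PMF β) (r : α → β → Prop) : Prop :=
  ∃ ρ : PMF (α × β), ρ.map Prod.fst = μ ∧ ρ.map Prod.snd = ν ∧ ∀ x ∈ ρ.support, r x.1 x.2

namespace Coupled

variable {α β α' β' : Type*} {μ : PMF α} {ν : PMF β} {r : α → β → Prop}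

theorem pure {a : α} {b : β} (h : r a b) : Coupled (PMF.pure a) (PMF.pure b) r :=
  ⟨PMF.pure (a, b), PMF.pure_map _ _, PMF.pure_map _ _, by simpa using h⟩

theorem bind {f : α → PMF α'} {g : β → PMF β'} {r' : α' → β' → Prop} (h : Coupled μ ν r)
    (hfg : ∀ a b, r a b → Coupled (f a) (g b) r') : Coupled (μ.bind f) (ν.bind g) r' := by
  obtain ⟨ρ, h1, h2, hr⟩ := h
  have key : ∀ x : α × β, ∃ ρ' : PMF (α' × β'), ρ'.map Prod.fst = f x.1 ∧
      ρ'.map Prod.snd = g x.2 ∧ (r x.1 x.2 → ∀ y ∈ ρ'.support, r' y.1 y.2) := by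
    intro x
    by_cases hx : r x.1 x.2
    · obtain ⟨ρ', h1, h2, h3⟩ := hfg _ _ hx
      exact ⟨ρ', h1, h2, fun _ => h3⟩
    -- Off the relation any coupling will do; the product makes the choice total.
    · refine ⟨(f x.1).bind fun c => (g x.2).map fun e => (c, e), ?_, ?_, fun h => absurd h hx⟩
      · simp only [PMF.map_bind, PMF.map_comp, Function.comp_def]
        exact (congrArg _ (funext fun a => PMF.map_const _ _)).trans (PMF.bind_pure _)
      · simp only [PMF.map_bind, PMF.map_comp, Function.comp_def]
        rw [PMF.bind_const]
        exact PMF.map_id _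
  choose ρ' h1' h2' h3' using key
  refine ⟨ρ.bind ρ', ?_, ?_, ?_⟩
  · rw [PMF.map_bind]
    simp only [h1']
    rw [← h1, PMF.bind_map]
    rfl
  · rw [PMF.map_bind]
    simp only [h2']
    rw [← h2, PMF.bind_map]
    rfl
  · intro y hy
    obtain ⟨x, hx, hy⟩ := (PMF.mem_support_bind_iff _ _ _).1 hy
    exact h3' x (hr x hx) y hy

theorem refl (μ : PMF α) : Coupled μ μ (· = ·) := by
  refine ⟨μ.map fun a => (a, a), ?_, ?_, ?_⟩
  · rw [PMF.map_comp]; exact PMF.map_id _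
  · rw [PMF.map_comp]; exact PMF.map_id _
  · intro x hx
    obtain ⟨a, -, rfl⟩ := (PMF.mem_support_map_iff _ _ _).1 hx
    rfl

theorem mono {r' : α → β → Prop} (h : Coupled μ ν r) (hr : ∀ a b, r a b → r' a b) :
    Coupled μ ν r' := by
  obtain ⟨ρ, h1, h2, h3⟩ := h
  exact ⟨ρ, h1, h2, fun x hx => hr _ _ (h3 x hx)⟩

theorem map_eq {γ : Type*} {f : α → γ} {g : β → γ} (h : Coupled μ ν fun a b => f a = g b) :
    μ.map f = ν.map g := by
  obtain ⟨ρ, rfl, rfl, h⟩ := h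
  rw [PMF.map_comp, PMF.map_comp, ← PMF.bind_pure_comp, ← PMF.bind_pure_comp]
  ext c
  rw [PMF.bind_apply, PMF.bind_apply]
  refine tsum_congr fun x => ?_
  by_cases hx : x ∈ ρ.support
  · simp only [Function.comp, h x hx]
  · rw [PMF.apply_eq_zero_iff _ _ |>.2 hx, zero_mul, zero_mul]

/-- Turns facts about the left component that are part of the relation into facts about every
possible outcome. -/
theorem exists_of_mem_support (h : Coupled μ ν r) {a : α} (ha : a ∈ μ.support) :
    ∃ b, r a b := by
  obtain ⟨ρ, rfl, -, h⟩ := h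
  obtain ⟨x, hx, rfl⟩ := (PMF.mem_support_map_iff _ _ _).1 ha
  exact ⟨x.2, h x hx⟩

end Coupled

namespace RealRAM

/-! ### Deterministic programs -/

/-- From a state with property `p`, the program `P` reaches without coin tosses a state with
property `q`. -/
def Det (P : Program) (p q : State → Prop) : Prop :=
  ∀ σ, p σ → ∃ τ, P.eval σ = PMF.pure τ ∧ q τ

namespace Det

variable {P Q : Program} {p q r : State → Prop}

theorem seq (h1 : Det P p q) (h2 : Det Q q r) : Det (.seq P Q) p r := by
  intro σ hσ
  obtain ⟨τ, e, hτ⟩ := h1 σ hσ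
  obtain ⟨υ, e', hυ⟩ := h2 τ hτ
  exact ⟨υ, by rw [Program.eval, e, PMF.pure_bind, e'], hυ⟩

theorem mono {p' q' : State → Prop} (h : Det P p q) (hp : ∀ σ, p' σ → p σ)
    (hq : ∀ σ, q σ → q' σ) : Det P p' q' := by
  intro σ hσ
  obtain ⟨τ, e, hτ⟩ := h σ (hp σ hσ)
  exact ⟨τ, e, hq τ hτ⟩

theorem ifLe {x y : RExp}
    (h1 : Det P (fun τ => ∃ σ, p σ ∧ x.val σ ≤ y.val σ ∧
      τ = σ.charge (x.cost + y.cost + 1) (max (x.top σ) (y.top σ))) q)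
    (h2 : Det Q (fun τ => ∃ σ, p σ ∧ y.val σ < x.val σ ∧
      τ = σ.charge (x.cost + y.cost + 1) (max (x.top σ) (y.top σ))) q) :
    Det (.ifLe x y P Q) p q := by
  intro σ hσ
  rw [Program.eval]
  split_ifs with h
  · exact h1 _ ⟨σ, hσ, h, rfl⟩
  · exact h2 _ ⟨σ, hσ, not_le.1 h, rfl⟩

theorem loop {x : ℕ} {a : NExp} {N : ℕ} (I : ℕ → State → Prop)
    (h0 : ∀ σ, p σ → a.val σ = N ∧ I 0 (σ.charge (a.cost + 1) 0))
    (hstep : ∀ m < N, Det P (fun τ => ∃ σ, I m σ ∧ τ = (σ.charge 1 m).writeReg x m) (I (m + 1))) :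
    Det (.loop x a P) p (I N) := by
  intro σ hσ
  obtain ⟨hN, hI⟩ := h0 σ hσ
  rw [Program.eval, hN]
  have : ∀ m ≤ N, ∃ τ, iterate x P.eval m (σ.charge (a.cost + 1) 0) = PMF.pure τ ∧ I m τ := by
    intro m
    induction m with
    | zero => exact fun _ => ⟨_, rfl, hI⟩
    | succ m ih =>
      intro hm
      obtain ⟨τ, e, hτ⟩ := ih (by omega)
      obtain ⟨υ, e', hυ⟩ := hstep m (by omega) _ ⟨τ, hτ, rfl⟩
      exact ⟨υ, by rw [iterate, e, PMF.pure_bind, e'], hυ⟩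
  exact this N le_rfl

end Det

/-! ### Views of a state -/

/-- The memory that suffices: the input and seven scratch cells. -/
def spaceBound (n d s : ℕ) : ℕ := n + 1 + n * d + n * s + 7

/-- The address of the `i`-th scratch cell. -/
def scratch (i : ℕ) : NExp :=
  .add (.add (.add (.add (.reg 0) (.const 1)) (.mul (.reg 0) (.reg 1)))
    (.mul (.reg 0) (.reg 2))) (.const i)

/-- The address of the output cell of the index in register `r`. -/
def outAddr (r : ℕ) : NExp := .add (.const 1) (.reg r)

/-- The address of the coordinate (in register `5`) of the key whose index is in register `r`. -/
def keyAddr (r : ℕ) : NExp :=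
  .add (.add (.add (.reg 0) (.const 1)) (.mul (.reg 1) (.reg r))) (.reg 5)

/-- The address of the coordinate (in register `5`) of the value whose index is in register `r`. -/
def valAddr (r : ℕ) : NExp :=
  .add (.add (.add (.add (.reg 0) (.const 1)) (.mul (.reg 0) (.reg 1)))
    (.mul (.reg 2) (.reg r))) (.reg 5)

variable {d s n : ℕ}

/-- The input is still in memory, the registers `3 ≤ r < L` hold `g r`, the scratch cells hold `S`,
the output cells hold `o`, the time is at most `T`, and the space is within `spaceBound`. -/
structure View (k : Fin n → EuclideanSpace ℝ (Fin d)) (v : Fin n → EuclideanSpace ℝ (Fin s))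
    (δ : ℝ) (L : ℕ) (g : ℕ → ℕ) (S : ℕ → ℝ) (o : Fin n → ℝ) (T : ℕ) (σ : State) : Prop where
  reg_n : σ.reg 0 = n
  reg_d : σ.reg 1 = d
  reg_s : σ.reg 2 = s
  reg : ∀ r, 3 ≤ r → r < L → σ.reg r = g r
  delta : σ.mem 0 = δ
  key : ∀ (j : Fin n) (a : Fin d), σ.mem (n + 1 + d * j + a) = k j a
  val : ∀ (j : Fin n) (b : Fin s), σ.mem (n + 1 + n * d + s * j + b) = v j b
  scr : ∀ i < 7, σ.mem (n + 1 + n * d + n * s + i) = S i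
  out : ∀ i : Fin n, σ.mem (1 + i) = o i
  time : σ.time ≤ T
  space : σ.space ≤ spaceBound n d s

theorem mul_add_lt {m j a e : ℕ} (hj : j < m) (ha : a < e) : e * j + a < m * e := by
  calc e * j + a < e * j + e := by omega
    _ = e * (j + 1) := by ring
    _ ≤ e * m := Nat.mul_le_mul_left _ hj
    _ = m * e := mul_comm _ _

namespace View

variable {k : Fin n → EuclideanSpace ℝ (Fin d)} {v : Fin n → EuclideanSpace ℝ (Fin s)}
  {δ : ℝ} {L : ℕ} {g : ℕ → ℕ} {S : ℕ → ℝ} {o : Fin n → ℝ} {T : ℕ} {σ : State}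

theorem mono (h : View k v δ L g S o T σ) {L' T' : ℕ} (hL : L' ≤ L) (hT : T ≤ T') :
    View k v δ L' g S o T' σ :=
  { h with
    reg := fun r h3 hr => h.reg r h3 (hr.trans_le hL)
    time := h.time.trans hT }

theorem charge (h : View k v δ L g S o T σ) {t m T' : ℕ} (hm : m ≤ spaceBound n d s)
    (hT : T + t ≤ T') : View k v δ L g S o T' (σ.charge t m) :=
  { h with
    time := (Nat.add_le_add_right h.time t).trans hT
    space := max_le h.space hm }

theorem writeReg (h : View k v δ L g S o T σ) (hL : 3 ≤ L) (x : ℕ) :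
    View k v δ (L + 1) (Function.update g L x) S o T (σ.writeReg L x) :=
  { h with
    reg_n := by simp [State.writeReg, Function.update_of_ne (show 0 ≠ L by omega), h.reg_n]
    reg_d := by simp [State.writeReg, Function.update_of_ne (show 1 ≠ L by omega), h.reg_d]
    reg_s := by simp [State.writeReg, Function.update_of_ne (show 2 ≠ L by omega), h.reg_s]
    reg := by
      intro r h3 hr
      by_cases hrL : r = L
      · simp [State.writeReg, hrL]
      · simp only [State.writeReg, Function.update_of_ne hrL]
        exact h.reg r h3 (by omega) }

theorem scratch_val (h : View k v δ L g S o T σ) (i : ℕ) :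
    (scratch i).val σ = n + 1 + n * d + n * s + i := by
  simp [scratch, NExp.val, h.reg_n, h.reg_d, h.reg_s]

theorem mem_scratch (h : View k v δ L g S o T σ) {i : ℕ} (hi : i < 7) :
    σ.mem ((scratch i).val σ) = S i := by
  rw [h.scratch_val, h.scr i hi]

theorem scratch_lt (h : View k v δ L g S o T σ) {i : ℕ} (hi : i < 7) :
    (scratch i).val σ < spaceBound n d s := by
  rw [h.scratch_val, spaceBound]; omega

theorem outAddr_val (h : View k v δ L g S o T σ) {r : ℕ} (hr : 3 ≤ r) (hrL : r < L) :
    (outAddr r).val σ = 1 + g r := by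
  simp [outAddr, NExp.val, h.reg r hr hrL]

theorem mem_outAddr (h : View k v δ L g S o T σ) {r : ℕ} (hr : 3 ≤ r) (hrL : r < L) {i : Fin n}
    (hi : g r = i) : σ.mem ((outAddr r).val σ) = o i := by
  rw [h.outAddr_val hr hrL, hi, h.out]

theorem outAddr_lt (h : View k v δ L g S o T σ) {r : ℕ} (hr : 3 ≤ r) (hrL : r < L) {i : Fin n}
    (hi : g r = i) : (outAddr r).val σ < spaceBound n d s := by
  rw [h.outAddr_val hr hrL, hi, spaceBound]
  have := i.2
  omega

theorem keyAddr_val (h : View k v δ L g S o T σ) {r : ℕ} (hr : 3 ≤ r) (hrL : r < L) (h5 : 5 < L) :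
    (keyAddr r).val σ = n + 1 + d * g r + g 5 := by
  simp [keyAddr, NExp.val, h.reg_n, h.reg_d, h.reg r hr hrL, h.reg 5 (by norm_num) h5]

theorem valAddr_val (h : View k v δ L g S o T σ) {r : ℕ} (hr : 3 ≤ r) (hrL : r < L) (h5 : 5 < L) :
    (valAddr r).val σ = n + 1 + n * d + s * g r + g 5 := by
  simp [valAddr, NExp.val, h.reg_n, h.reg_d, h.reg_s, h.reg r hr hrL, h.reg 5 (by norm_num) h5]

theorem writeScratch (h : View k v δ L g S o T σ) {i : ℕ} (hi : i < 7) (y : ℝ) :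
    View k v δ L g (Function.update S i y) o T (σ.writeCell ((scratch i).val σ) y) := by
  have e := h.scratch_val i
  have hne : ∀ a, a < n + 1 + n * d + n * s →
      (σ.writeCell ((scratch i).val σ) y).mem a = σ.mem a := by
    intro a ha
    simp only [State.writeCell]
    rw [Function.update_of_ne (by omega)]
  exact
  { h with
    delta := by rw [hne _ (by omega), h.delta]
    key := fun j a => by
      have := mul_add_lt j.2 a.2
      rw [hne _ (by omega), h.key]
    val := fun j b => by
      have := mul_add_lt j.2 b.2
      rw [hne _ (by omega), h.val]
    out := fun j => by
      have := j.2
      rw [hne _ (by omega), h.out]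
    scr := fun i' hi' => by
      simp only [State.writeCell, e]
      by_cases hii : i' = i
      · simp [hii]
      · rw [Function.update_of_ne hii, Function.update_of_ne (by omega), h.scr i' hi'] }

theorem writeOut (h : View k v δ L g S o T σ) (j : Fin n) (y : ℝ) :
    View k v δ L g S (Function.update o j y) T (σ.writeCell (1 + j) y) := by
  have hj := j.2
  have hne : ∀ a, (a = 0 ∨ n < a) → (σ.writeCell (1 + j) y).mem a = σ.mem a := by
    intro a ha
    simp only [State.writeCell]
    rw [Function.update_of_ne (by omega)]
  exact
  { h with
    delta := by rw [hne _ (by omega), h.delta]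
    key := fun j a => by rw [hne _ (by omega), h.key]
    val := fun j b => by rw [hne _ (by omega), h.val]
    scr := fun i' hi' => by rw [hne _ (by omega), h.scr i' hi']
    out := fun i => by
      simp only [State.writeCell]
      by_cases hij : i = j
      · simp [hij]
      · rw [Function.update_of_ne hij, Function.update_of_ne, h.out]
        have : (i : ℕ) ≠ j := fun h => hij (Fin.ext h)
        omega }

end View

/-! ### Rules for assignments, counting loops and inner products -/

section Rules

variable {k : Fin n → EuclideanSpace ℝ (Fin d)} {v : Fin n → EuclideanSpace ℝ (Fin s)}
  {δ : ℝ} {L : ℕ} {g : ℕ → ℕ} {S : ℕ → ℝ} {o : Fin n → ℝ} {T T' : ℕ}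

/-- The overhead `14` is the cost `13` of the scratch address plus the write. -/
theorem det_setScratch {i : ℕ} (hi : i < 7) {x : RExp} {y : ℝ}
    (hx : ∀ σ, View k v δ L g S o T σ → x.val σ = y ∧ x.top σ ≤ spaceBound n d s)
    (hT : T + (x.cost + 14) ≤ T') :
    Det (.setCell (scratch i) x) (View k v δ L g S o T)
      (View k v δ L g (Function.update S i y) o T') := by
  intro σ hσ
  obtain ⟨hy, htop⟩ := hx σ hσ
  refine ⟨_, rfl, ?_⟩
  rw [hy]
  refine (hσ.charge (max_le htop (hσ.scratch_lt hi)) ?_).writeScratch hi y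
  refine le_trans (le_of_eq ?_) hT
  simp only [scratch, NExp.cost]
  ring

theorem det_setOut {j : Fin n} {r : ℕ} (hr : 3 ≤ r) (hrL : r < L) (hj : g r = j) {x : RExp} {y : ℝ}
    (hx : ∀ σ, View k v δ L g S o T σ → x.val σ = y ∧ x.top σ ≤ spaceBound n d s)
    (hT : T + (x.cost + 4) ≤ T') :
    Det (.setCell (outAddr r) x) (View k v δ L g S o T)
      (View k v δ L g S (Function.update o j y) T') := by
  intro σ hσ
  obtain ⟨hy, htop⟩ := hx σ hσ
  refine ⟨_, rfl, ?_⟩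
  rw [hy]
  have e := hσ.outAddr_val hr hrL
  have hlt := hσ.outAddr_lt hr hrL hj
  rw [hj] at e
  rw [e] at hlt ⊢
  refine (hσ.charge (max_le htop hlt) ?_).writeOut j y
  refine le_trans (le_of_eq ?_) hT
  simp only [outAddr, NExp.cost]
  ring

/-- A loop over the first free register, with an invariant on the scratch and output cells. -/
theorem det_loop {P : Program} {a : NExp} {N c : ℕ} (I : ℕ → (ℕ → ℝ) → (Fin n → ℝ) → Prop)
    (hL : 3 ≤ L) (hN : N ≤ spaceBound n d s)
    (ha : ∀ σ, View k v δ L g S o T σ → a.val σ = N) (h0 : I 0 S o)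
    (hstep : ∀ m < N, ∀ S o T, I m S o → Det P
      (View k v δ (L + 1) (Function.update g L m) S o T)
      (fun σ => ∃ S' o', I (m + 1) S' o' ∧
        View k v δ (L + 1) (Function.update g L m) S' o' (T + c) σ))
    (hT : T + (a.cost + 1) + N * (c + 1) ≤ T') :
    Det (.loop L a P) (View k v δ L g S o T)
      (fun σ => ∃ S' o', I N S' o' ∧ View k v δ L g S' o' T' σ) := by
  refine (Det.loop (p := View k v δ L g S o T) (N := N) (fun m σ => ∃ S' o', I m S' o' ∧
    View k v δ L g S' o' (T + (a.cost + 1) + m * (c + 1)) σ) ?_ ?_).mono (fun _ h => h) ?_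
  · intro σ hσ
    exact ⟨ha σ hσ, S, o, h0, hσ.charge (Nat.zero_le _) (by omega)⟩
  · rintro m hm τ ⟨σ, ⟨S', o', hI, hσ⟩, rfl⟩
    obtain ⟨τ, e, S'', o'', hI', hτ⟩ := hstep m hm S' o' _ hI _
      ((hσ.charge (t := 1) (m := m) (by omega) le_rfl).writeReg hL m)
    refine ⟨τ, e, S'', o'', hI', ?_⟩
    -- Lowering the level to `L` forgets the loop counter, so the next round starts from the same
    -- view.
    have hτ' := hτ.mono (L' := L) (Nat.le_succ L)
      (T' := T + (a.cost + 1) + (m + 1) * (c + 1)) (by ring_nf; omega)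
    exact { hτ' with
      reg := fun r h3 hr => by
        rw [hτ'.reg r h3 hr, Function.update_of_ne hr.ne] }
  · rintro σ ⟨S', o', hI, hσ⟩
    exact ⟨S', o', hI, hσ.mono le_rfl hT⟩

/-- Set scratch cell `t` to the sum of `x * y` over the values `0, 1, …` of register `5`. -/
def dot (t len : ℕ) (x y : RExp) : Program :=
  .seq (.setCell (scratch t) (.nat (.const 0)))
    (.loop 5 (.reg len) (.setCell (scratch t) (.add (.cell (scratch t)) (.mul x y))))

theorem det_dot {t len N : ℕ} (ht : t < 7) {x y : RExp} (f : ℕ → ℝ)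
    (hN : N ≤ spaceBound n d s)
    (hlen : ∀ S T σ, View k v δ 5 g S o T σ → σ.reg len = N)
    (hxy : ∀ m < N, ∀ S T σ, View k v δ 6 (Function.update g 5 m) S o T σ →
      x.val σ * y.val σ = f m ∧ x.top σ ≤ spaceBound n d s ∧ y.top σ ≤ spaceBound n d s)
    (hT : T + 18 + N * (x.cost + y.cost + 31) ≤ T') :
    Det (dot t len x y) (View k v δ 5 g S o T)
      (View k v δ 5 g (Function.update S t (∑ m ∈ Finset.range N, f m)) o T') := by
  refine Det.seq (det_setScratch (y := 0) (T' := T + 16) ht (by simp [RExp.val, RExp.top, NExp.val])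
    (by simp [RExp.cost, NExp.cost])) ?_
  refine (det_loop (c := x.cost + y.cost + 30) (N := N) (T' := T')
    (fun m S' o' => o' = o ∧ S' = Function.update S t (∑ m ∈ Finset.range m, f m))
    (by norm_num) hN (fun σ hσ => by simpa [NExp.val] using hlen _ _ σ hσ) (by simp) ?_ ?_).mono
    (fun _ h => h) ?_
  · rintro m hm S' o' T₁ ⟨rfl, rfl⟩
    refine (det_setScratch (y := ∑ m ∈ Finset.range (m + 1), f m)
      (T' := T₁ + (x.cost + y.cost + 30)) ht ?_ ?_).mono (fun _ h => h) ?_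
    · intro σ hσ
      obtain ⟨e, h1, h2⟩ := hxy m hm _ _ σ hσ
      have h3 := hσ.scratch_lt ht
      refine ⟨?_, ?_⟩
      · rw [RExp.val, RExp.val, RExp.val, e, hσ.mem_scratch ht, Function.update_self,
          Finset.sum_range_succ]
      · simp only [RExp.top]
        exact max_le h3 (max_le h1 h2)
    · simp only [RExp.cost, scratch, NExp.cost]; omega
    · intro σ hσ
      rw [Function.update_idem] at hσ
      exact ⟨_, _, ⟨rfl, rfl⟩, hσ⟩
  · simp only [NExp.cost]
    have e : x.cost + y.cost + 30 + 1 = x.cost + y.cost + 31 := rfl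
    rw [e]; omega
  · rintro σ ⟨S', o', ⟨rfl, rfl⟩, hσ⟩
    exact hσ

/-- Scratch cell `5` becomes the inner product of the keys with indices in registers `4`, `3`. -/
def dotKey : Program := dot 5 1 (.cell (keyAddr 4)) (.cell (keyAddr 3))

/-- Scratch cell `6` becomes the inner product of the values with indices in registers `4`, `3`. -/
def dotVal : Program := dot 6 2 (.cell (valAddr 4)) (.cell (valAddr 3))

theorem det_dotKey {i j : Fin n} (hi : g 4 = i) (hj : g 3 = j) (hT : T + 18 + d * 51 ≤ T') :
    Det dotKey (View k v δ 5 g S o T)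
      (View k v δ 5 g (Function.update S 5 (inner ℝ (k i) (k j))) o T') := by
  -- Values of the loop counter are charged as memory; `d` fits under `spaceBound` because there is
  -- at least one key.
  have hn : 0 < n := i.pos
  have hd : d ≤ spaceBound n d s := by
    have : d ≤ n * d := Nat.le_mul_of_pos_left d hn
    rw [spaceBound]; omega
  refine (det_dot (N := d) (by norm_num)
    (fun m => if h : m < d then k i ⟨m, h⟩ * k j ⟨m, h⟩ else 0) hd
    (fun S T σ h => h.reg_d) ?_ (by simpa [RExp.cost, keyAddr, NExp.cost] using hT)).mono
    (fun _ h => h) ?_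
  · intro m hm S T σ h
    have h1 := h.keyAddr_val (r := 4) (by norm_num) (by norm_num) (by norm_num)
    have h2 := h.keyAddr_val (r := 3) (by norm_num) (by norm_num) (by norm_num)
    simp [hi, hj] at h1 h2
    have := mul_add_lt i.2 hm
    have := mul_add_lt j.2 hm
    refine ⟨?_, ?_, ?_⟩
    · rw [RExp.val, RExp.val, h1, h2, dif_pos hm, ← h.key i ⟨m, hm⟩, ← h.key j ⟨m, hm⟩]
    · rw [RExp.top, h1, spaceBound]; omega
    · rw [RExp.top, h2, spaceBound]; omega
  · intro σ hσ
    convert hσ using 2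
    rw [Finset.sum_range]
    simp [PiLp.inner_apply, mul_comm]

theorem det_dotVal {i j : Fin n} (hi : g 4 = i) (hj : g 3 = j) (hT : T + 18 + s * 59 ≤ T') :
    Det dotVal (View k v δ 5 g S o T)
      (View k v δ 5 g (Function.update S 6 (inner ℝ (v i) (v j))) o T') := by
  have hn : 0 < n := i.pos
  have hd : s ≤ spaceBound n d s := by
    have : s ≤ n * s := Nat.le_mul_of_pos_left s hn
    rw [spaceBound]; omega
  refine (det_dot (N := s) (by norm_num)
    (fun m => if h : m < s then v i ⟨m, h⟩ * v j ⟨m, h⟩ else 0) hd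
    (fun S T σ h => h.reg_s) ?_ (by simpa [RExp.cost, valAddr, NExp.cost] using hT)).mono
    (fun _ h => h) ?_
  · intro m hm S T σ h
    have h1 := h.valAddr_val (r := 4) (by norm_num) (by norm_num) (by norm_num)
    have h2 := h.valAddr_val (r := 3) (by norm_num) (by norm_num) (by norm_num)
    simp [hi, hj] at h1 h2
    have := mul_add_lt i.2 hm
    have := mul_add_lt j.2 hm
    refine ⟨?_, ?_, ?_⟩
    · rw [RExp.val, RExp.val, h1, h2, dif_pos hm, ← h.val i ⟨m, hm⟩, ← h.val j ⟨m, hm⟩]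
    · rw [RExp.top, h1, spaceBound]; omega
    · rw [RExp.top, h2, spaceBound]; omega
  · intro σ hσ
    convert hσ using 2
    rw [Finset.sum_range]
    simp [PiLp.inner_apply, mul_comm]

end Rules

end RealRAM

/-! ### Reformulations of the walk and of the radii that match the program -/

namespace SoftmaxBalance

variable {d s n : ℕ}

/-- `signs` recurses on the first round and `iterate` on the last one; this bridges the two. -/
theorem signs_concat (k : Fin n → EuclideanSpace ℝ (Fin d)) (v : Fin n → EuclideanSpace ℝ (Fin s))
    (c R : ℝ) (l : List (Fin n)) (j : Fin n) (η : Fin n → ℝ) :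
    signs k v c R (l ++ [j]) η =
      (signs k v c R l η).bind fun o => o.elim (PMF.pure none) fun η' => signs k v c R [j] η' := by
  induction l generalizing η with
  | nil => rw [List.nil_append, signs.eq_1 k v c R η, PMF.pure_bind]; rfl
  | cons i l ih =>
    rw [List.cons_append, signs, signs.eq_2 k v c R η i l]
    split_ifs
    · rw [PMF.pure_bind]; rfl
    · rw [PMF.bind_bind]
      exact congrArg _ (funext fun b => ih _)

theorem sum_sign_eq {η : Fin n → ℝ} (hη : ∀ i, η i = 1 ∨ η i = -1) :
    ∑ i, η i = ((Finset.univ.filter fun i => η i = 1).card : ℝ) -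
      (Finset.univ.filter fun i => η i = -1).card := by
  have h : ∀ i, η i = (if η i = 1 then (1 : ℝ) else 0) - if η i = -1 then 1 else 0 := by
    intro i
    rcases hη i with h | h <;> rw [h] <;> norm_num
  rw [Finset.sum_congr rfl fun i _ => h i, Finset.sum_sub_distrib, Finset.sum_boole,
    Finset.sum_boole]

/-- The sum of the signs is the difference of the class sizes, so its sign decides which class is
smaller, with ties going to `+1`. -/
theorem select_eq_filter {η : Fin n → ℝ} (hη : ∀ i, η i = 1 ∨ η i = -1) :
    select η = Finset.univ.filter fun i => (if ∑ i, η i ≤ 0 then η i else -η i) = 1 := by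
  have h : ∑ i, η i ≤ 0 ↔ (Finset.univ.filter fun i => η i = 1).card ≤
      (Finset.univ.filter fun i => η i = -1).card := by
    rw [sum_sign_eq hη, sub_nonpos, Nat.cast_le]
  unfold select
  simp only [h]
  split_ifs
  · rfl
  · simp only [neg_eq_iff_eq_neg]

theorem correlation_eq_sum_range (k : Fin n → EuclideanSpace ℝ (Fin d))
    (v : Fin n → EuclideanSpace ℝ (Fin s)) (η : Fin n → ℝ) (j : Fin n) :
    correlation k v η j = ∑ i ∈ Finset.range (j + 1), if h : i < n then
      (Real.exp (inner ℝ (k ⟨i, h⟩) (k j) / Real.sqrt d) * inner ℝ (v ⟨i, h⟩) (v j)) * η ⟨i, h⟩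
      else 0 := by
  rw [Nat.range_succ_eq_Iic, ← Fin.map_valEmbedding_Iic, Finset.sum_map, correlation]
  refine Finset.sum_congr rfl fun i _ => ?_
  simp

end SoftmaxBalance

/-- `x` is the maximum of `0` and of the first `m` values of the nonnegative function `f`, or of
more values of it. -/
def IsPrefixMax {n : ℕ} (m : ℕ) (f : Fin n → ℝ) (x : ℝ) : Prop :=
  (∀ j : Fin n, (j : ℕ) < m → f j ≤ x) ∧ (x = 0 ∨ ∃ j, x = f j)

theorem IsPrefixMax.succ {n m : ℕ} {f : Fin n → ℝ} {x : ℝ} (h : IsPrefixMax m f x) (hm : m < n) :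
    IsPrefixMax (m + 1) f (max x (f ⟨m, hm⟩)) := by
  refine ⟨fun j hj => ?_, ?_⟩
  · rcases Nat.lt_succ_iff_lt_or_eq.1 hj with hj | hj
    · exact (h.1 j hj).trans (le_max_left _ _)
    · obtain rfl : j = ⟨m, hm⟩ := Fin.ext hj
      exact le_max_right _ _
  · rcases max_choice x (f ⟨m, hm⟩) with e | e
    · rw [e]; exact h.2
    · exact Or.inr ⟨_, e⟩

/-- The program needs only squared radii: both enter `c * R ^ 2` through their squares. -/
theorem IsPrefixMax.eq_iSup_sq {n : ℕ} {E : Type*} [NormedAddCommGroup E] {f : Fin n → E} {x : ℝ}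
    (h : IsPrefixMax n (fun j => ‖f j‖ ^ 2) x) (hn : 0 < n) : x = (⨆ j, ‖f j‖) ^ 2 := by
  have : Nonempty (Fin n) := ⟨⟨0, hn⟩⟩
  refine le_antisymm ?_ ?_
  · rcases h.2 with rfl | ⟨j, rfl⟩
    · positivity
    · exact pow_le_pow_left₀ (norm_nonneg _)
        (le_ciSup (f := fun j => ‖f j‖) (Set.finite_range _).bddAbove j) 2
  · obtain ⟨j, hj⟩ := exists_eq_ciSup_of_finite (f := fun j => ‖f j‖)
    rw [← hj]
    exact h.1 j j.2

/-! ### The program -/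

namespace RealRAM

variable {d s n : ℕ}

/-- Scratch cell `i` becomes the maximum of the scratch cells `i` and `j`. -/
def maxTo (i j : ℕ) : Program :=
  .ifLe (.cell (scratch j)) (.cell (scratch i)) .skip
    (.setCell (scratch i) (.cell (scratch j)))

/-- The scratch cells `0` and `1` become the maximal squared norms of the keys and values. -/
def maxNorms : Program :=
  .loop 3 (.reg 0) (.seq (.setReg 4 (.reg 3)) (.seq dotKey (.seq dotVal
    (.seq (maxTo 0 5) (maxTo 1 6)))))

/-- The exponential factor of the scale. -/
def scaleExp : RExp :=
  .exp (.div (.cell (scratch 0)) (.mul (.nat (.const 2)) (.sqrt (.nat (.reg 1)))))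

/-- The bound on the correlations. -/
def boundExp : RExp :=
  .mul (.mul (.nat (.const 30)) (.log (.div (.nat (.reg 0)) (.cell (.const 0)))))
    (.mul (.mul scaleExp scaleExp) (.cell (scratch 1)))

/-- The summand of the correlation for the index in register `4`. -/
def termExp : RExp :=
  .mul (.mul (.exp (.div (.cell (scratch 5)) (.sqrt (.nat (.reg 1))))) (.cell (scratch 6)))
    (.cell (outAddr 4))

/-- Scratch cell `4` becomes the correlation for the index in register `3`. -/
def correlate : Program :=
  .seq (.setCell (scratch 4) (.nat (.const 0)))
    (.loop 4 (.add (.reg 3) (.const 1)) (.seq dotKey (.seq dotVal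
      (.setCell (scratch 4) (.add (.cell (scratch 4)) termExp)))))

/-- The bias of the coin. -/
def biasExp : RExp :=
  .sub (.div (.nat (.const 1)) (.nat (.const 2)))
    (.div (.cell (scratch 4)) (.mul (.nat (.const 2)) (.cell (scratch 2))))

/-- Choose the sign of the index in register `3`. -/
def toss : Program :=
  .seq (.flip (outAddr 3) biasExp)
    (.setCell (outAddr 3) (.sub (.mul (.nat (.const 2)) (.cell (outAddr 3))) (.nat (.const 1))))

/-- Record the failure. -/
def markFailure : Program := .setCell (scratch 3) (.nat (.const 0))

/-- One round of the balancing walk. -/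
def balanceRound : Program :=
  .ifLe (.cell (scratch 3)) (.nat (.const 0)) .skip
    (.seq correlate (.ifLe (.cell (scratch 4)) (.cell (scratch 2))
      (.ifLe (.sub (.nat (.const 0)) (.cell (scratch 4))) (.cell (scratch 2)) toss markFailure)
      markFailure))

/-- Scratch cell `4` becomes the sum of the signs. -/
def sumSigns : Program :=
  .seq (.setCell (scratch 4) (.nat (.const 0)))
    (.loop 3 (.reg 0) (.setCell (scratch 4) (.add (.cell (scratch 4)) (.cell (outAddr 3)))))

/-- Reverse all signs. -/
def negateSigns : Program :=
  .loop 3 (.reg 0) (.setCell (outAddr 3) (.sub (.nat (.const 0)) (.cell (outAddr 3))))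

/-- Select the smaller class and write the status to cell `0`. -/
def finish : Program :=
  .seq sumSigns (.seq (.ifLe (.cell (scratch 4)) (.nat (.const 0)) .skip negateSigns)
    (.setCell (.const 0) (.cell (scratch 3))))

/-- SoftmaxBalance on the real-RAM. -/
def softmaxBalance : Program :=
  .seq maxNorms (.seq (.setCell (scratch 2) boundExp)
    (.seq (.setCell (scratch 3) (.nat (.const 1)))
      (.seq (.loop 3 (.reg 0) balanceRound) finish)))

/-! ### Correctness and cost of the deterministic pieces -/

section Correctness

variable {k : Fin n → EuclideanSpace ℝ (Fin d)} {v : Fin n → EuclideanSpace ℝ (Fin s)}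
  {δ : ℝ} {L : ℕ} {g : ℕ → ℕ} {S : ℕ → ℝ} {o : Fin n → ℝ} {T T' : ℕ}

theorem det_skip (hT : T + 1 ≤ T') :
    Det .skip (View k v δ L g S o T) (View k v δ L g S o T') :=
  fun _ hσ => ⟨_, rfl, hσ.charge (Nat.zero_le _) hT⟩

theorem det_setReg (hL : 3 ≤ L) {a : NExp} {N : ℕ} (hN : N ≤ spaceBound n d s)
    (ha : ∀ σ, View k v δ L g S o T σ → a.val σ = N) (hT : T + (a.cost + 1) ≤ T') :
    Det (.setReg L a) (View k v δ L g S o T)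
      (View k v δ (L + 1) (Function.update g L N) S o T') := by
  intro σ hσ
  refine ⟨_, rfl, ?_⟩
  rw [ha σ hσ]
  exact (hσ.charge hN hT).writeReg hL N

theorem det_maxTo {i j : ℕ} (hi : i < 7) (hj : j < 7) (hT : T + 57 ≤ T') :
    Det (maxTo i j) (View k v δ L g S o T)
      (View k v δ L g (Function.update S i (max (S i) (S j))) o T') := by
  refine Det.ifLe ?_ ?_
  · refine (det_skip (k := k) (v := v) (δ := δ) (L := L) (g := g)
      (S := Function.update S i (max (S i) (S j))) (o := o) (T := T + 29) (by omega)).mono ?_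
      fun _ h => h
    rintro τ ⟨σ, hσ, hle, rfl⟩
    rw [RExp.val, RExp.val, hσ.mem_scratch hi, hσ.mem_scratch hj] at hle
    rw [max_eq_left hle, Function.update_eq_self]
    exact hσ.charge (max_le (hσ.scratch_lt hj) (hσ.scratch_lt hi))
      (by simp [RExp.cost, scratch, NExp.cost])
  · by_cases hlt : S i < S j
    · refine (det_setScratch (k := k) (v := v) (δ := δ) (L := L) (g := g) (S := S) (o := o)
        (T := T + 29) (y := max (S i) (S j)) hi ?_ ?_).mono ?_ fun _ h => h
      · intro σ hσ
        rw [RExp.val, hσ.mem_scratch hj, max_eq_right hlt.le]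
        exact ⟨rfl, hσ.scratch_lt hj⟩
      · simp [RExp.cost, scratch, NExp.cost]; omega
      · rintro τ ⟨σ, hσ, -, rfl⟩
        exact hσ.charge (max_le (hσ.scratch_lt hj) (hσ.scratch_lt hi))
          (by simp [RExp.cost, scratch, NExp.cost])
    · rintro τ ⟨σ, hσ, hlt', rfl⟩
      rw [RExp.val, RExp.val, hσ.mem_scratch hi, hσ.mem_scratch hj] at hlt'
      exact absurd hlt' hlt

theorem det_maxNorms (hT : T + 2 + n * (153 + 51 * d + 59 * s) ≤ T') :
    Det maxNorms (View k v δ 3 g 0 o T) (fun σ => ∃ S,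
      (IsPrefixMax n (fun j => ‖k j‖ ^ 2) (S 0) ∧ IsPrefixMax n (fun j => ‖v j‖ ^ 2) (S 1)) ∧
      View k v δ 3 g S o T' σ) := by
  refine (det_loop (N := n) (c := 152 + 51 * d + 59 * s) (T' := T')
    (fun m S o' => o' = o ∧ IsPrefixMax m (fun j => ‖k j‖ ^ 2) (S 0) ∧
      IsPrefixMax m (fun j => ‖v j‖ ^ 2) (S 1)) le_rfl (by rw [spaceBound]; omega)
    (fun σ hσ => by simpa [NExp.val] using hσ.reg_n) ?_ ?_ ?_).mono (fun _ h => h) ?_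
  · simp [IsPrefixMax]
  · rintro m hm S o' T₁ ⟨rfl, hk, hv⟩
    refine Det.seq (det_setReg (N := m) (T' := T₁ + 2) (by norm_num) (by rw [spaceBound]; omega)
      (fun σ hσ => by simpa [NExp.val] using hσ.reg 3 le_rfl (by norm_num)) (by simp [NExp.cost])) ?_
    refine Det.seq (det_dotKey (i := ⟨m, hm⟩) (j := ⟨m, hm⟩) (T' := T₁ + 2 + 18 + d * 51)
      (by simp) (by simp) le_rfl) ?_
    refine Det.seq (det_dotVal (i := ⟨m, hm⟩) (j := ⟨m, hm⟩)
      (T' := T₁ + 2 + 18 + d * 51 + 18 + s * 59) (by simp) (by simp) le_rfl) ?_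
    refine Det.seq (det_maxTo (by norm_num) (by norm_num) le_rfl) ?_
    refine (det_maxTo (by norm_num) (by norm_num) le_rfl).mono (fun _ h => h) ?_
    intro σ hσ
    refine ⟨_, _, ⟨rfl, ?_, ?_⟩, { hσ.mono (L' := 4) (by norm_num)
      (T' := T₁ + (152 + 51 * d + 59 * s)) (by omega) with
      reg := fun r h3 hr => by
        rw [hσ.reg r h3 (by omega), Function.update_of_ne hr.ne] }⟩
    · simpa using hk.succ hm
    · simpa using hv.succ hm
  · have e : 152 + 51 * d + 59 * s + 1 = 153 + 51 * d + 59 * s := by omega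
    rw [e]
    exact hT
  · rintro σ ⟨S, o', ⟨rfl, h1, h2⟩, hσ⟩
    exact ⟨S, ⟨h1, h2⟩, hσ⟩

theorem det_setBound (hk : S 0 = (⨆ j, ‖k j‖) ^ 2) (hv : S 1 = (⨆ j, ‖v j‖) ^ 2)
    (hT : T + 100 ≤ T') :
    Det (.setCell (scratch 2) boundExp) (View k v δ L g S o T)
      (View k v δ L g (Function.update S 2 (SoftmaxBalance.threshold n δ *
        SoftmaxBalance.scale d (⨆ j, ‖k j‖) (⨆ j, ‖v j‖) ^ 2)) o T') := by
  refine det_setScratch (by norm_num) ?_ ?_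
  · intro σ hσ
    have h0 := hσ.mem_scratch (i := 0) (by norm_num)
    have h1 := hσ.mem_scratch (i := 1) (by norm_num)
    have h0' := hσ.scratch_lt (i := 0) (by norm_num)
    have h1' := hσ.scratch_lt (i := 1) (by norm_num)
    constructor
    · simp only [boundExp, scaleExp, RExp.val, NExp.val, h0, h1, hσ.reg_n, hσ.reg_d, hσ.delta,
        hk, hv, SoftmaxBalance.threshold, SoftmaxBalance.scale]
      push_cast
      ring
    · simp only [boundExp, scaleExp, RExp.top, NExp.val, max_le_iff]
      simp only [spaceBound] at *
      omega
  · simp [boundExp, scaleExp, RExp.cost, scratch, NExp.cost]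
    omega

theorem det_correlate {j : Fin n} (hj : g 3 = j)
    (hT : T + 20 + (j + 1) * (105 + 51 * d + 59 * s) ≤ T') :
    Det correlate (View k v δ 4 g S o T) (fun σ => ∃ S',
      (S' 4 = SoftmaxBalance.correlation k v o j ∧ S' 2 = S 2 ∧ S' 3 = S 3) ∧
      View k v δ 4 g S' o T' σ) := by
  refine Det.seq (det_setScratch (y := 0) (T' := T + 16) (by norm_num)
    (by simp [RExp.val, RExp.top, NExp.val]) (by simp [RExp.cost, NExp.cost])) ?_
  -- The `j + 1` rounds match the sum over `Iic j`, diagonal included.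
  refine (det_loop (N := j + 1) (c := 104 + 51 * d + 59 * s) (T' := T')
    (fun m S' o' => o' = o ∧ S' 4 = (∑ i ∈ Finset.range m, if h : i < n then
      (Real.exp (inner ℝ (k ⟨i, h⟩) (k j) / Real.sqrt d) * inner ℝ (v ⟨i, h⟩) (v j)) * o ⟨i, h⟩
      else 0) ∧ S' 2 = S 2 ∧ S' 3 = S 3) (by norm_num) (by rw [spaceBound]; have := j.2; omega)
    (fun σ hσ => by simp [NExp.val, hσ.reg 3 le_rfl (by norm_num), hj]) (by simp) ?_ ?_).mono
    (fun _ h => h) ?_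
  · rintro m hm S' o' T₁ ⟨rfl, h4, h2, h3⟩
    have hmn : m < n := by have := j.2; omega
    have hg4 : Function.update g 4 m 4 = ((⟨m, hmn⟩ : Fin n) : ℕ) := by simp
    have hg3 : Function.update g 4 m 3 = j := by simpa using hj
    refine Det.seq (det_dotKey (i := ⟨m, hmn⟩) (j := j) (T' := T₁ + 18 + d * 51)
      hg4 hg3 le_rfl) ?_
    refine Det.seq (det_dotVal (i := ⟨m, hmn⟩) (j := j)
      (T' := T₁ + 18 + d * 51 + 18 + s * 59) hg4 hg3 le_rfl) ?_
    refine (det_setScratch (T' := T₁ + (104 + 51 * d + 59 * s)) (y := S' 4 +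
      (Real.exp (inner ℝ (k ⟨m, hmn⟩) (k j) / Real.sqrt d) * inner ℝ (v ⟨m, hmn⟩) (v j)) *
        o' ⟨m, hmn⟩) (by norm_num) ?_ ?_).mono (fun _ h => h) ?_
    · intro σ hσ
      have e4 := hσ.mem_scratch (i := 4) (by norm_num)
      have e5 := hσ.mem_scratch (i := 5) (by norm_num)
      have e6 := hσ.mem_scratch (i := 6) (by norm_num)
      have l4 := hσ.scratch_lt (i := 4) (by norm_num)
      have l5 := hσ.scratch_lt (i := 5) (by norm_num)
      have l6 := hσ.scratch_lt (i := 6) (by norm_num)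
      have eo := hσ.mem_outAddr (r := 4) (by norm_num) (by norm_num) hg4
      have lo := hσ.outAddr_lt (r := 4) (by norm_num) (by norm_num) hg4
      constructor
      · simp only [termExp, RExp.val, NExp.val, e4, e5, e6, eo, hσ.reg_d]
        simp
      · simp only [termExp, RExp.top, max_le_iff]
        omega
    · simp [termExp, RExp.cost, scratch, outAddr, NExp.cost]
      omega
    · intro σ hσ
      refine ⟨_, _, ⟨rfl, ?_, ?_, ?_⟩, hσ⟩
      · rw [Function.update_self, Finset.sum_range_succ, dif_pos hmn, h4]
      · simpa using h2
      · simpa using h3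
  · have e : 104 + 51 * d + 59 * s + 1 = 105 + 51 * d + 59 * s := by omega
    rw [e]
    simp only [NExp.cost]
    omega
  · rintro σ ⟨S', o', ⟨rfl, h4, h2, h3⟩, hσ⟩
    exact ⟨S', ⟨by rw [h4, SoftmaxBalance.correlation_eq_sum_range], h2, h3⟩, hσ⟩

theorem det_sumSigns (hT : T + 18 + n * 34 ≤ T') :
    Det sumSigns (View k v δ 3 g S o T) (fun σ => ∃ S',
      (S' 4 = ∑ i, o i ∧ S' 3 = S 3) ∧ View k v δ 3 g S' o T' σ) := by
  refine Det.seq (det_setScratch (y := 0) (T' := T + 16) (by norm_num)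
    (by simp [RExp.val, RExp.top, NExp.val]) (by simp [RExp.cost, NExp.cost])) ?_
  refine (det_loop (N := n) (c := 33) (T' := T')
    (fun m S' o' => o' = o ∧ S' 4 = (∑ i ∈ Finset.range m, if h : i < n then o ⟨i, h⟩ else 0) ∧
      S' 3 = S 3) le_rfl (by rw [spaceBound]; omega) (fun σ hσ => by simpa [NExp.val] using hσ.reg_n) (by simp) ?_ ?_).mono
    (fun _ h => h) ?_
  · rintro m hm S' o' T₁ ⟨rfl, h4, h3⟩
    have hg3 : Function.update g 3 m 3 = ((⟨m, hm⟩ : Fin n) : ℕ) := by simp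
    refine (det_setScratch (T' := T₁ + 33) (y := S' 4 + o' ⟨m, hm⟩) (by norm_num) ?_ ?_).mono
      (fun _ h => h) ?_
    · intro σ hσ
      have e4 := hσ.mem_scratch (i := 4) (by norm_num)
      have l4 := hσ.scratch_lt (i := 4) (by norm_num)
      have eo := hσ.mem_outAddr (r := 3) (by norm_num) (by norm_num) hg3
      have lo := hσ.outAddr_lt (r := 3) (by norm_num) (by norm_num) hg3
      refine ⟨by rw [RExp.val, RExp.val, RExp.val, e4, eo], ?_⟩
      simp only [RExp.top, max_le_iff]
      omega
    · simp [RExp.cost, scratch, outAddr, NExp.cost]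
    · intro σ hσ
      refine ⟨_, _, ⟨rfl, ?_, ?_⟩, hσ⟩
      · rw [Function.update_self, Finset.sum_range_succ, dif_pos hm, h4]
      · simpa using h3
  · simp only [NExp.cost]; omega
  · rintro σ ⟨S', o', ⟨rfl, h4, h3⟩, hσ⟩
    exact ⟨S', ⟨by rw [h4, Finset.sum_range]; simp, h3⟩, hσ⟩

theorem det_negateSigns (hT : T + 2 + n * 12 ≤ T') :
    Det negateSigns (View k v δ 3 g S o T) (View k v δ 3 g S (fun i => -o i) T') := by
  refine (det_loop (N := n) (c := 11) (T' := T')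
    (fun m S' o' => S' = S ∧ o' = fun i : Fin n => if (i : ℕ) < m then -o i else o i)
    le_rfl (by rw [spaceBound]; omega) (fun σ hσ => by simpa [NExp.val] using hσ.reg_n) (by simp) ?_ ?_).mono
    (fun _ h => h) ?_
  · rintro m hm S' o' T₁ ⟨rfl, rfl⟩
    have hg3 : Function.update g 3 m 3 = ((⟨m, hm⟩ : Fin n) : ℕ) := by simp
    refine (det_setOut (T' := T₁ + 11) (y := -o ⟨m, hm⟩) (by norm_num) (by norm_num) hg3
      ?_ ?_).mono (fun _ h => h) ?_
    · intro σ hσ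
      have eo := hσ.mem_outAddr (r := 3) (by norm_num) (by norm_num) hg3
      have lo := hσ.outAddr_lt (r := 3) (by norm_num) (by norm_num) hg3
      refine ⟨by simp [RExp.val, NExp.val, eo], ?_⟩
      simp only [RExp.top, max_le_iff]
      omega
    · simp [RExp.cost, outAddr, NExp.cost]
    · intro σ hσ
      refine ⟨_, _, ⟨rfl, ?_⟩, hσ⟩
      funext i
      by_cases hi : i = ⟨m, hm⟩
      · simp [hi]
      · have hi' : (i : ℕ) ≠ m := fun h => hi (Fin.ext h)
        rw [Function.update_of_ne hi]
        have : (i : ℕ) < m + 1 ↔ (i : ℕ) < m := by omega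
        simp only [this]
  · simp only [NExp.cost]; omega
  · rintro σ ⟨S', o', ⟨rfl, rfl⟩, hσ⟩
    simpa using hσ

/-- Cell `0`, which held `δ`, now receives the status, so the view is lost; the conclusion keeps
what `output` reads and the resources. -/
theorem det_finish :
    Det finish (View k v δ 3 g S o T) (fun σ => σ.mem 0 = S 3 ∧
      (∀ i : Fin n, σ.mem (1 + i) = if ∑ i, o i ≤ 0 then o i else -o i) ∧
      σ.time ≤ T + 60 + n * 46 ∧ σ.space ≤ spaceBound n d s) := by
  refine Det.seq (det_sumSigns le_rfl) ?_
  rintro σ ⟨S', ⟨h4, h3⟩, hσ⟩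
  refine Det.seq (q := View k v δ 3 g S' (fun i => if ∑ i, o i ≤ 0 then o i else -o i)
    (T + 37 + n * 46)) (Det.ifLe ?_ ?_) ?_ σ hσ
  · rintro τ ⟨σ, hσ, hle, rfl⟩
    rw [RExp.val.eq_2, hσ.mem_scratch (by norm_num), h4] at hle
    have hle' : ∑ i, o i ≤ 0 := by simpa [RExp.val, NExp.val] using hle
    simp only [hle', if_true]
    refine det_skip le_rfl _ (hσ.charge ?_ le_rfl) |>.imp fun τ h => ⟨h.1, h.2.mono le_rfl ?_⟩
    · simpa [RExp.top] using hσ.scratch_lt (i := 4) (by norm_num)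
    · simp only [RExp.cost, scratch, NExp.cost]; omega
  · rintro τ ⟨σ, hσ, hlt, rfl⟩
    rw [RExp.val.eq_2, hσ.mem_scratch (by norm_num), h4] at hlt
    have hlt' : ¬ ∑ i, o i ≤ 0 := by simpa [RExp.val, NExp.val] using hlt
    simp only [hlt', if_false]
    refine det_negateSigns le_rfl _ (hσ.charge ?_ le_rfl) |>.imp fun τ h =>
      ⟨h.1, h.2.mono le_rfl ?_⟩
    · simpa [RExp.top] using hσ.scratch_lt (i := 4) (by norm_num)
    · simp only [RExp.cost, scratch, NExp.cost]; omega
  · intro σ hσ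
    have h := hσ.mem_scratch (i := 3) (by norm_num)
    have hlt := hσ.scratch_lt (i := 3) (by norm_num)
    refine ⟨_, rfl, ?_, ?_, ?_, ?_⟩
    · simp [State.writeCell, NExp.val, RExp.val, h, h3]
    · intro i
      simp only [State.writeCell, NExp.val]
      rw [Function.update_of_ne (by omega)]
      exact hσ.out i
    · have := hσ.time
      simp only [State.writeCell, State.charge, RExp.cost, scratch, NExp.cost]
      omega
    · have := hσ.space
      simp only [State.writeCell, State.charge, RExp.top, NExp.val]
      rw [spaceBound] at *
      omega

end Correctness

end RealRAM

/-! ### Coupling the program with the walk -/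

namespace RealRAM

open SoftmaxBalance

variable {d s n : ℕ} {k : Fin n → EuclideanSpace ℝ (Fin d)} {v : Fin n → EuclideanSpace ℝ (Fin s)}
  {δ : ℝ} {L : ℕ} {g : ℕ → ℕ} {S : ℕ → ℝ} {o : Fin n → ℝ} {T T' : ℕ} {σ : State} {c R : ℝ}

theorem View.forget (h : View k v δ L g S o T σ) (hT : T ≤ T') : View k v δ 3 0 S o T' σ :=
  { h with
    reg := fun _ h3 hr => absurd h3 (not_le.2 hr)
    time := h.time.trans hT }

/-- The machine state `σ` represents the state of the walk after `m` rounds, for the bound `M`. -/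
def Tracks (k : Fin n → EuclideanSpace ℝ (Fin d)) (v : Fin n → EuclideanSpace ℝ (Fin s)) (δ M : ℝ)
    (m T : ℕ) (σ : State) : Option (Fin n → ℝ) → Prop
  | none => ∃ S o, S 3 = 0 ∧ View k v δ 3 0 S o T σ
  | some η => ∃ S, (S 3 = 1 ∧ S 2 = M) ∧ (∀ i : Fin n, (i : ℕ) < m → η i = 1 ∨ η i = -1) ∧
      View k v δ 3 0 S η T σ

theorem Det.eval_seq {P Q : Program} {p q : State → Prop} (h : Det P p q) (hσ : p σ) :
    ∃ τ, (Program.seq P Q).eval σ = Q.eval τ ∧ q τ := by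
  obtain ⟨τ, e, hτ⟩ := h σ hσ
  exact ⟨τ, by rw [Program.eval, e, PMF.pure_bind], hτ⟩

theorem det_markFailure (M : ℝ) (m : ℕ) (hT : T + 16 ≤ T') (hσ : View k v δ L g S o T σ) :
    ∃ τ, markFailure.eval σ = PMF.pure τ ∧ Tracks k v δ M m T' τ none := by
  obtain ⟨τ, e, hτ⟩ := det_setScratch (x := .nat (.const 0)) (y := 0) (T' := T') (i := 3) (by norm_num)
    (by simp [RExp.val, RExp.top, NExp.val]) (by simpa [RExp.cost, NExp.cost] using hT) σ hσ
  exact ⟨τ, e, _, _, by simp, hτ.forget le_rfl⟩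

/-- Both sides use the same coin. The biases agree even when `c * R ^ 2 = 0`, since division by zero
gives `0` in both expressions. -/
theorem coupled_toss {j : Fin n} (hj : g 3 = j) (hσ : View k v δ 4 g S o T σ) (h3 : S 3 = 1)
    (h2 : S 2 = c * R ^ 2) (h4 : S 4 = correlation k v o j)
    (ho : ∀ i : Fin n, i < j → o i = 1 ∨ o i = -1) (hT : T + 60 ≤ T') :
    Coupled (toss.eval σ)
      ((coin (1 / 2 - correlation k v o j / (2 * c * R ^ 2))).bind fun b =>
        PMF.pure (some (Function.update o j (if b then 1 else -1))))
      (Tracks k v δ (c * R ^ 2) (j + 1) T') := by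
  have e2 := hσ.mem_scratch (i := 2) (by norm_num)
  have e4 := hσ.mem_scratch (i := 4) (by norm_num)
  have l2 := hσ.scratch_lt (i := 2) (by norm_num)
  have l4 := hσ.scratch_lt (i := 4) (by norm_num)
  have lo := hσ.outAddr_lt (r := 3) le_rfl (by norm_num) hj
  have hbias : biasExp.val σ = 1 / 2 - correlation k v o j / (2 * c * R ^ 2) := by
    simp only [biasExp, RExp.val, NExp.val, e2, e4, h2, h4]
    push_cast
    rw [mul_assoc]
  have htop : biasExp.top σ ≤ spaceBound n d s := by
    simp only [biasExp, RExp.top, max_le_iff]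
    omega
  rw [toss, Program.eval, Program.eval, hbias, PMF.bind_map]
  refine (Coupled.refl _).bind ?_
  rintro b _ rfl
  have hcell : (outAddr 3).val σ = 1 + j := by
    rw [hσ.outAddr_val le_rfl (by norm_num), hj]
  rw [hcell] at lo
  have hσ' := (hσ.charge (t := (outAddr 3).cost + biasExp.cost + 1)
    (m := max (biasExp.top σ) (1 + j + 1)) (T' := T + 42)
    (max_le htop lo) (by simp [outAddr, biasExp, RExp.cost, NExp.cost, scratch])).writeOut j
    (if b then 1 else 0)
  have hx : ∀ υ, View k v δ 4 g S (Function.update o j (if b then 1 else 0)) (T + 42) υ →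
      (RExp.sub (.mul (.nat (.const 2)) (.cell (outAddr 3))) (.nat (.const 1))).val υ =
        (if b then 1 else -1) ∧
      (RExp.sub (.mul (.nat (.const 2)) (.cell (outAddr 3))) (.nat (.const 1))).top υ ≤
        spaceBound n d s := by
    intro σ hσ
    have eo := hσ.mem_outAddr (r := 3) le_rfl (by norm_num) hj
    have lo := hσ.outAddr_lt (r := 3) le_rfl (by norm_num) hj
    constructor
    · simp only [RExp.val, NExp.val, eo, Function.update_self]
      cases b <;> norm_num
    · simp only [RExp.top, max_le_iff]
      omega
  obtain ⟨τ, e, hτ⟩ := det_setOut (x := .sub (.mul (.nat (.const 2)) (.cell (outAddr 3)))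
    (.nat (.const 1))) (y := if b then 1 else -1) (T' := T') le_rfl (by norm_num) hj hx
    (by simp only [RExp.cost, NExp.cost, outAddr]; omega) _ hσ'
  simp only [Function.comp]
  rw [hcell, e]
  refine Coupled.pure ⟨S, ⟨h3, h2⟩, ?_, ?_⟩
  · intro i hi
    by_cases hij : i = j
    · rw [hij, Function.update_self]
      cases b <;> simp
    · rw [Function.update_of_ne hij]
      have : (i : ℕ) ≠ j := fun h => hij (Fin.ext h)
      exact ho i (Fin.lt_def.2 (by omega))
  · rw [Function.update_idem] at hτ
    exact hτ.forget le_rfl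

/-- The test on the absolute value is split into two one-sided comparisons, and either violation
clears the flag in scratch cell `3`. -/
theorem coupled_balanceRound {j : Fin n} (hj : g 3 = j) (hσ : View k v δ 4 g S o T σ)
    (h3 : S 3 = 1) (h2 : S 2 = c * R ^ 2) (ho : ∀ i : Fin n, i < j → o i = 1 ∨ o i = -1)
    (hT : T + 200 + n * (105 + 51 * d + 59 * s) ≤ T') :
    Coupled (balanceRound.eval σ) (signs k v c R [j] o)
      (Tracks k v δ (c * R ^ 2) (j + 1) T') := by
  have e3 := hσ.mem_scratch (i := 3) (by norm_num)
  have l3 := hσ.scratch_lt (i := 3) (by norm_num)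
  have hle : (j + 1 : ℕ) * (105 + 51 * d + 59 * s) ≤ n * (105 + 51 * d + 59 * s) :=
    Nat.mul_le_mul_right _ j.2
  have halive : ¬ (RExp.cell (scratch 3)).val σ ≤ (RExp.nat (.const 0)).val σ := by
    simp [RExp.val, NExp.val, e3, h3]
  rw [balanceRound, Program.eval, if_neg halive]
  obtain ⟨τ, e, S', ⟨h4', h2', h3'⟩, hτ⟩ := Det.eval_seq
    (det_correlate (T' := T + 37 + (j + 1) * (105 + 51 * d + 59 * s)) hj (by omega))
    (hσ.charge (t := 17) (m := (scratch 3).val σ + 1) (T' := T + 17) l3 le_rfl)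
    (Q := .ifLe (.cell (scratch 4)) (.cell (scratch 2))
      (.ifLe (.sub (.nat (.const 0)) (.cell (scratch 4))) (.cell (scratch 2)) toss markFailure)
      markFailure)
  have hcost : (RExp.cell (scratch 3)).cost + (RExp.nat (.const 0)).cost + 1 = 17 := rfl
  have htop : max (RExp.top σ (.cell (scratch 3))) (RExp.top σ (.nat (.const 0))) =
      (scratch 3).val σ + 1 := by simp [RExp.top]
  rw [hcost, htop, e]
  set T₁ := T + 37 + (j + 1) * (105 + 51 * d + 59 * s) with hT₁
  rw [h2] at h2'
  rw [h3] at h3'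
  have e2 := hτ.mem_scratch (i := 2) (by norm_num)
  have e4 := hτ.mem_scratch (i := 4) (by norm_num)
  have l2 := hτ.scratch_lt (i := 2) (by norm_num)
  have l4 := hτ.scratch_lt (i := 4) (by norm_num)
  have hfail : ∀ υ : State, View k v δ 4 g S' o (T₁ + 100) υ →
      c * R ^ 2 < |correlation k v o j| → Coupled (markFailure.eval υ) (signs k v c R [j] o)
      (Tracks k v δ (c * R ^ 2) (j + 1) T') := by
    intro υ hυ h
    obtain ⟨ω, e, hω⟩ := det_markFailure (c * R ^ 2) (j + 1) (T' := T') (by omega) hυ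
    rw [e, signs, if_pos h]
    exact Coupled.pure hω
  rw [Program.eval]
  have hυ := hτ.charge (t := (RExp.cell (scratch 4)).cost + (RExp.cell (scratch 2)).cost + 1)
    (m := max (RExp.top τ (.cell (scratch 4))) (RExp.top τ (.cell (scratch 2)))) (T' := T₁ + 29)
    (max_le l4 l2) le_rfl
  split_ifs with hle1
  · rw [RExp.val, RExp.val, e4, e2, h4', h2'] at hle1
    rw [Program.eval]
    set υ := τ.charge ((RExp.cell (scratch 4)).cost + (RExp.cell (scratch 2)).cost + 1)
      (max (RExp.top τ (.cell (scratch 4))) (RExp.top τ (.cell (scratch 2))))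
    have e2 := hυ.mem_scratch (i := 2) (by norm_num)
    have e4 := hυ.mem_scratch (i := 4) (by norm_num)
    have l2 := hυ.scratch_lt (i := 2) (by norm_num)
    have l4 := hυ.scratch_lt (i := 4) (by norm_num)
    have hω := hυ.charge (t := (RExp.sub (.nat (.const 0)) (.cell (scratch 4))).cost +
      (RExp.cell (scratch 2)).cost + 1)
      (m := max (RExp.top υ (.sub (.nat (.const 0)) (.cell (scratch 4))))
        (RExp.top υ (.cell (scratch 2)))) (T' := T₁ + 29 + 32)
      (max_le (by simp only [RExp.top, max_le_iff]; omega) l2) le_rfl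
    have hneg : (RExp.sub (.nat (.const 0)) (.cell (scratch 4))).val υ =
        -correlation k v o j := by
      simp [RExp.val, NExp.val, e4, h4']
    have hval : (RExp.cell (scratch 2)).val υ = c * R ^ 2 := by rw [RExp.val, e2, h2']
    rw [hneg, hval]
    split_ifs with hle2
    · have habs : ¬ c * R ^ 2 < |correlation k v o j| :=
        not_lt.2 (abs_le.2 ⟨by linarith, hle1⟩)
      rw [signs, if_neg habs]
      simp only [signs]
      exact coupled_toss hj hω h3' h2' h4' ho (by omega)
    · exact hfail _ (hω.mono le_rfl (by omega)) (lt_abs.2 (Or.inr (not_le.1 hle2)))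
  · rw [RExp.val, RExp.val, e4, e2, h4', h2'] at hle1
    exact hfail _ (hυ.mono le_rfl (by omega)) (lt_abs.2 (Or.inl (not_le.1 hle1)))

theorem eval_balanceRound_of_failed {M : ℝ} {m : ℕ} (hσ : View k v δ L g S o T σ) (h3 : S 3 = 0)
    (hT : T + 18 ≤ T') :
    ∃ τ, balanceRound.eval σ = PMF.pure τ ∧ Tracks k v δ M m T' τ none := by
  have e3 := hσ.mem_scratch (i := 3) (by norm_num)
  have l3 := hσ.scratch_lt (i := 3) (by norm_num)
  have hle : (RExp.cell (scratch 3)).val σ ≤ (RExp.nat (.const 0)).val σ := by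
    simp [RExp.val, NExp.val, e3, h3]
  rw [balanceRound, Program.eval, if_pos hle]
  refine ⟨_, rfl, S, o, h3, ((hσ.charge (T' := T + 17) (max_le l3 (Nat.zero_le _)) le_rfl).charge
    (Nat.zero_le _) le_rfl).forget hT⟩

/-- A loop cannot be left early: after a failure the remaining rounds only see the cleared flag and
pass, while the walk stays at `none`. -/
theorem coupled_loop (hσ : View k v δ 3 g S 0 T σ) (h3 : S 3 = 1) (h2 : S 2 = c * R ^ 2)
    (hT : T + 2 + n * (201 + n * (105 + 51 * d + 59 * s)) ≤ T') :
    Coupled ((Program.loop 3 (.reg 0) balanceRound).eval σ) (signs k v c R (List.finRange n) 0)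
      (Tracks k v δ (c * R ^ 2) n T') := by
  set C := 201 + n * (105 + 51 * d + 59 * s) with hC
  have key : ∀ m ≤ n, Coupled (iterate 3 balanceRound.eval m (σ.charge 2 0))
      (signs k v c R ((List.finRange n).take m) 0)
      (Tracks k v δ (c * R ^ 2) m (T + 2 + m * C)) := by
    intro m
    induction m with
    | zero =>
      intro _
      rw [List.take_zero, signs, iterate]
      exact Coupled.pure ⟨S, ⟨h3, h2⟩, by simp,
        (hσ.charge (Nat.zero_le _) le_rfl).forget (by omega)⟩
    | succ m ih =>
      intro hm
      have hlt : m < (List.finRange n).length := by rw [List.length_finRange]; omega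
      rw [List.take_succ_eq_append_getElem hlt, List.getElem_finRange, signs_concat, iterate]
      have hCm : T + 2 + (m + 1) * C = T + 2 + m * C + C := by ring
      have hsp : m ≤ spaceBound n d s := by rw [spaceBound]; omega
      refine (ih (by omega)).bind ?_
      rintro τ (_ | η) hτ
      · obtain ⟨S', o', h3', hτ⟩ := hτ
        obtain ⟨υ, e, hυ⟩ := eval_balanceRound_of_failed (M := c * R ^ 2) (m := m + 1)
          (T' := T + 2 + (m + 1) * C) ((hτ.charge (t := 1) hsp le_rfl).writeReg le_rfl m) h3'
          (by omega)
        rw [e]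
        exact Coupled.pure hυ
      · obtain ⟨S', ⟨h3', h2'⟩, hη, hτ⟩ := hτ
        exact coupled_balanceRound (j := ⟨m, by omega⟩) (by simp)
          ((hτ.charge (t := 1) hsp le_rfl).writeReg le_rfl m) h3' h2' (fun i hi => hη i hi)
          (by omega)
  have h := key n le_rfl
  rw [List.take_of_length_le (by rw [List.length_finRange])] at h
  rw [Program.eval, NExp.val, hσ.reg_n]
  refine h.mono ?_
  rintro τ (_ | η) h
  · obtain ⟨S', o', h3', hτ⟩ := h
    exact ⟨S', o', h3', hτ.forget hT⟩
  · obtain ⟨S', h', hη, hτ⟩ := h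
    exact ⟨S', h', hη, hτ.forget hT⟩

theorem view_input (k : Fin n → EuclideanSpace ℝ (Fin d)) (v : Fin n → EuclideanSpace ℝ (Fin s))
    (δ : ℝ) : View k v δ 3 0 0 0 0 (input k v δ) where
  reg_n := rfl
  reg_d := rfl
  reg_s := rfl
  reg := fun r h3 hr => absurd h3 (not_le.2 hr)
  delta := rfl
  key := fun j a => by
    have h := mul_add_lt j.2 a.2
    have e : n + 1 + d * j + a - (n + 1) = d * j + a := by omega
    simp only [input, inputMem]
    rw [if_neg (by omega), if_neg (by omega), dif_pos (by omega)]
    have : (⟨n + 1 + d * j + a - (n + 1), by omega⟩ : Fin (n * d)) = finProdFinEquiv (j, a) := by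
      ext
      simp [e]
      ring
    rw [this, Equiv.symm_apply_apply]
  val := fun j b => by
    have h := mul_add_lt j.2 b.2
    have e : n + 1 + n * d + s * j + b - (n + 1 + n * d) = s * j + b := by omega
    simp only [input, inputMem]
    rw [if_neg (by omega), if_neg (by omega), dif_neg (by omega), dif_pos (by omega)]
    have : (⟨n + 1 + n * d + s * j + b - (n + 1 + n * d), by omega⟩ : Fin (n * s)) =
        finProdFinEquiv (j, b) := by
      ext
      simp [e]
      ring
    rw [this, Equiv.symm_apply_apply]
  scr := fun i _ => by
    simp only [input, inputMem]
    rw [if_neg (by omega), if_neg (by omega), dif_neg (by omega), dif_neg (by omega)]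
    rfl
  out := fun i => by
    have := i.2
    simp only [input, inputMem]
    rw [if_neg (by omega), if_pos (by omega)]
    rfl
  time := le_rfl
  space := by simp only [input, spaceBound]; omega

/-- The total running time. -/
def timeBound (n d s : ℕ) : ℕ :=
  300 + n * (153 + 51 * d + 59 * s) + n * (201 + n * (105 + 51 * d + 59 * s)) + n * 46

theorem coupled_softmaxBalance (k : Fin n → EuclideanSpace ℝ (Fin d))
    (v : Fin n → EuclideanSpace ℝ (Fin s)) (δ : ℝ) (hn : 0 < n) :
    Coupled (softmaxBalance.run k v δ)
      (signs k v (threshold n δ) (scale d (⨆ j, ‖k j‖) (⨆ j, ‖v j‖)) (List.finRange n) 0)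
      (fun σ o => output n σ = Option.map select o ∧ σ.time ≤ timeBound n d s ∧
        σ.space ≤ spaceBound n d s) := by
  set T₁ := 2 + n * (153 + 51 * d + 59 * s) with hT₁
  set T₂ := T₁ + 200 + 2 + n * (201 + n * (105 + 51 * d + 59 * s)) with hT₂
  rw [Program.run, softmaxBalance]
  obtain ⟨σ₁, e₁, S₁, ⟨hk, hv⟩, h₁⟩ := Det.eval_seq (det_maxNorms (T' := T₁) (by omega))
    (view_input k v δ) (Q := .seq (.setCell (scratch 2) boundExp)
    (.seq (.setCell (scratch 3) (.nat (.const 1)))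
      (.seq (.loop 3 (.reg 0) balanceRound) finish)))
  obtain ⟨σ₂, e₂, h₂⟩ := Det.eval_seq (det_setBound (T' := T₁ + 100) (hk.eq_iSup_sq hn)
    (hv.eq_iSup_sq hn) le_rfl) h₁ (Q := .seq (.setCell (scratch 3) (.nat (.const 1)))
      (.seq (.loop 3 (.reg 0) balanceRound) finish))
  obtain ⟨σ₃, e₃, h₃⟩ := Det.eval_seq (det_setScratch (i := 3) (x := .nat (.const 1)) (y := 1)
    (T' := T₁ + 200) (by norm_num) (by simp [RExp.val, RExp.top, NExp.val])
    (by simp only [RExp.cost, NExp.cost]; omega)) h₂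
    (Q := .seq (.loop 3 (.reg 0) balanceRound) finish)
  -- The trivial `bind` on the side of the walk is the partner of `finish`.
  rw [e₁, e₂, e₃, Program.eval, ← PMF.bind_pure (signs _ _ _ _ _ _)]
  refine (coupled_loop (T' := T₂) h₃ (by simp) (by simp) le_rfl).bind ?_
  have hbound : T₂ + 60 + n * 46 ≤ timeBound n d s := by rw [timeBound]; omega
  rintro σ (_ | η) hσ
  · obtain ⟨S, o, h3, hσ⟩ := hσ
    obtain ⟨τ, e, h0, -, ht, hs⟩ := det_finish σ hσ
    rw [e]
    refine Coupled.pure ⟨?_, ht.trans hbound, hs⟩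
    rw [output, h0, h3, if_neg zero_ne_one]
    rfl
  · obtain ⟨S, ⟨h3, -⟩, hη, hσ⟩ := hσ
    obtain ⟨τ, e, h0, hout, ht, hs⟩ := det_finish σ hσ
    rw [e]
    refine Coupled.pure ⟨?_, ht.trans hbound, hs⟩
    rw [output, h0, h3, if_pos rfl, Option.map_some, select_eq_filter fun i => hη i i.2]
    simp only [hout]

theorem timeBound_le (hd : 0 < d) (hs : 0 < s) (hn : 0 < n) :
    timeBound n d s ≤ 10000 * ((d + s) * n ^ 2) := by
  have h1 : n * (d + s) ≤ (d + s) * n ^ 2 := by nlinarith [Nat.mul_le_mul_left (n * (d + s)) hn]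
  have h2 : n ≤ n * (d + s) := Nat.le_mul_of_pos_right n (by omega)
  have h3 : n * n ≤ (d + s) * n ^ 2 := by nlinarith [Nat.zero_le (n * n)]
  have e : timeBound n d s ≤ 300 + 400 * n + 200 * (n * (d + s)) + 105 * (n * n) +
      60 * ((d + s) * n ^ 2) := by
    rw [timeBound]
    nlinarith [Nat.zero_le (n * d), Nat.zero_le (n * s), Nat.zero_le (n * n * d),
      Nat.zero_le (n * n * s)]
  omega

theorem spaceBound_le (hd : 0 < d) (hs : 0 < s) (hn : 0 < n) :
    spaceBound n d s ≤ 10000 * ((d + s) * n) := by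
  have h2 : n ≤ (d + s) * n := Nat.le_mul_of_pos_left n (by omega)
  have e : (d + s) * n = n * d + n * s := by ring
  rw [spaceBound]
  omega

end RealRAM

/-! ### Radii in the form of the theorem, and conclusion -/

namespace SoftmaxBalance

theorem scale_iSup_eq {d s n : ℕ} (hn : 0 < n) (k : Fin n → EuclideanSpace ℝ (Fin d))
    (v : Fin n → EuclideanSpace ℝ (Fin s)) :
    scale d (⨆ j, ‖k j‖) (⨆ j, ‖v j‖) =
      Real.exp (⨆ j, ‖k j‖ ^ 2 / (2 * Real.sqrt d)) * ⨆ j, ‖v j‖ := by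
  have : Nonempty (Fin n) := ⟨⟨0, hn⟩⟩
  have hmono : (⨆ j, ‖k j‖) ^ 2 / (2 * Real.sqrt d) = ⨆ j, ‖k j‖ ^ 2 / (2 * Real.sqrt d) := by
    refine le_antisymm ?_ ?_
    · obtain ⟨j, hj⟩ := exists_eq_ciSup_of_finite (f := fun j => ‖k j‖)
      rw [← hj]
      exact le_ciSup (f := fun j => ‖k j‖ ^ 2 / (2 * Real.sqrt d))
        (Set.finite_range _).bddAbove j
    · refine ciSup_le fun j => ?_
      have := le_ciSup (f := fun j => ‖k j‖) (Set.finite_range _).bddAbove j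
      gcongr
  rw [scale, hmono]

end SoftmaxBalance

end

theorem theorem3 :
    ∃ (P : RealRAM.Program) (K : ℝ), 0 < K ∧
      ∀ (d s n : ℕ), 0 < d → 0 < s → 0 < n →
      ∀ (k : Fin n → EuclideanSpace ℝ (Fin d)) (v : Fin n → EuclideanSpace ℝ (Fin s)) (δ : ℝ),
        0 < δ →
        -- the program implements SoftmaxBalance, for the least radii
        (P.run k v δ).map (RealRAM.output n) =
            SoftmaxBalance.law k v (⨆ j, ‖k j‖) (⨆ j, ‖v j‖) δ ∧
        -- the output has at most half the size of the dataset
        (∀ S : Finset (Fin n), some S ∈ ((P.run k v δ).map (RealRAM.output n)).support →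
          (S.card : ℝ) ≤ (n : ℝ) / 2) ∧
        -- the balancing guarantee for every fixed query
        (2 * δ ≤ (n : ℝ) * s → ∀ q : EuclideanSpace ℝ (Fin d),
          ENNReal.ofReal (1 - δ) ≤
            ((P.run k v δ).map (RealRAM.output n)).toOuterMeasure
              {o | ∃ S : Finset (Fin n), o = some S ∧
                ‖SoftmaxBalance.expSum k v q S - SoftmaxBalance.expSum k v q Sᶜ‖ ≤
                  K * (Real.sqrt s * Real.log (n * s / δ) *
                    Real.exp (‖q‖ ^ 2 / (2 * Real.sqrt d)) *
                    Real.exp (⨆ j, ‖k j‖ ^ 2 / (2 * Real.sqrt d)) * ⨆ j, ‖v j‖)}) ∧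
        -- running time and memory, for all outcomes of the coin tosses
        ∀ σ ∈ (P.run k v δ).support,
          (σ.time : ℝ) ≤ K * ((d + s) * (n : ℝ) ^ 2) ∧ (σ.space : ℝ) ≤ K * ((d + s) * (n : ℝ)) := by
  -- The constant is dictated by `timeBound_le` and `spaceBound_le`; the balancing guarantee needs
  -- only `18`.
  refine ⟨RealRAM.softmaxBalance, 10000, by norm_num, ?_⟩
  intro d s n hd hs hn k v δ hδ
  have hc := RealRAM.coupled_softmaxBalance k v δ hn
  have hlaw : (RealRAM.softmaxBalance.run k v δ).map (RealRAM.output n) =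
      SoftmaxBalance.law k v (⨆ j, ‖k j‖) (⨆ j, ‖v j‖) δ :=
    (hc.mono fun _ _ h => h.1).map_eq
  refine ⟨hlaw, ?_, ?_, ?_⟩
  · intro S hS
    rw [hlaw] at hS
    exact SoftmaxBalance.card_le_of_mem_support_law hS
  · intro hns q
    rw [hlaw]
    refine SoftmaxBalance.guarantee
      (fun j => le_ciSup (f := fun j => ‖k j‖) (Set.finite_range _).bddAbove j)
      (fun j => le_ciSup (f := fun j => ‖v j‖) (Set.finite_range _).bddAbove j)
      hδ hn hs hns q ?_
    rw [SoftmaxBalance.scale_iSup_eq hn]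
    have hlog : 0 ≤ Real.log (n * s / δ) :=
      Real.log_nonneg (by rw [le_div_iff₀ hδ]; linarith)
    have hv : 0 ≤ ⨆ j, ‖v j‖ := Real.iSup_nonneg fun j => norm_nonneg _
    rw [← mul_assoc (Real.exp (‖q‖ ^ 2 / (2 * Real.sqrt d))), ← mul_assoc (Real.sqrt s * _),
      ← mul_assoc (Real.sqrt s * _)]
    exact mul_le_mul_of_nonneg_right (by norm_num) (by positivity)
  · intro σ hσ
    obtain ⟨_, -, ht, hsp⟩ := hc.exists_of_mem_support hσ
    have h1 := ht.trans (RealRAM.timeBound_le hd hs hn)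
    have h2 := hsp.trans (RealRAM.spaceBound_le hd hs hn)
    constructor
    · exact_mod_cast h1
    · exact_mod_cast h2
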